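/- Let $p>1$, $\gamma\in\mathbb{R}\setminus\{0\}$ and $\omega>\gamma^2/4$, and let $$\varphi_{\omega,\gamma}(x)=\left[\frac{(p+1)\omega}{2}\,\mathrm{sech}^2\!\left(\frac{(p-1)\sqrt{\omega}}{2}|x|+\tanh^{-1}\!\Big(\frac{\gamma}{2\sqrt{\omega}}\Big)\right)\right]^{\frac{1}{p-1}},\qquad x\in\mathbb{R},$$ be the positive solution in $H^1(\mathbb{R})$ of $-\varphi''+\omega\varphi-\gamma\delta\varphi-|\varphi|^{p-1}\varphi=0$, where $\delta$ is the Dirac distribution at $0$. For $j=1,2$ put $V_1=p\,\varphi_{\omega,\gamma}^{p-1}$, $V_2=\varphi_{\omega,\gamma}^{p-1}$ and, for $v,z\in H^1(\mathbb{R},\mathbb{R})$, $$B_j(v,z)=\int_{\mathbb{R}} v'z'\,dx+\omega\int_{\mathbb{R}} vz\,dx-\gamma v(0)z(0)-\int_{\mathbb{R}} V_j\,vz\,dx .$$ Let $L_j=-\partial_x^2+\omega-\gamma\delta-V_j$ be the operator in $L^2(\mathbb{R},\mathbb{R})$ defined by this form: its domain $D(L_j)$ consists of all $v\in H^1(\mathbb{R},\mathbb{R})$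 for which there is $w\in L^2(\mathbb{R},\mathbb{R})$ with $B_j(v,z)=\int_{\mathbb{R}} wz\,dx$ for all $z\in H^1(\mathbb{R},\mathbb{R})$, and then $L_jv=w$. Let $H_\omega^\gamma$ be the real-linear operator in $L^2(\mathbb{R},\mathbb{C})$ (a real Hilbert space with scalar product $\mathrm{Re}\int u\bar v\,dx$) given by $$H_\omega^\gamma(u_1+iu_2)=L_1u_1+i\,L_2u_2,\qquad u_1\in D(L_1),\ u_2\in D(L_2),$$ and let its spectrum, a subset of $\mathbb{C}$, be that of its complexification. Then: (i) $H_\omega^\gamma$ has only finitely many negative eigenvalues, counted with multiplicity. (ii) The kernel of $H_\omega^\gamma$ is $\mathrm{span}_{\mathbb{R}}\{i\varphi_{\omega,\gamma}\}$. (iii) The rest of the spectrum of $H_\omega^\gamma$ is positive and bounded away from $0$: there is $\delta_0>0$ such that every point of the spectrum which is neither $0$ nor a negative eigenvalue is real and at least $\delta_0$. Moreover, $\ker L_1=\{0\}$. -/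

import Mathlib

open MeasureTheory
open scoped ENNReal

noncomputable section

namespace DeltaNLS

/-- The real Hilbert space `L²(ℝ, ℝ)`. -/
abbrev L2R := Lp ℝ 2 (volume : Measure ℝ)

/-- The space `L²(ℝ, ℂ)`; it is used below as a real Hilbert space, with scalar product
`Re ∫ u v̄`. -/
abbrev L2C := Lp ℂ 2 (volume : Measure ℝ)

/-- The profile
`φ(x) = [ (p+1)ω/2 · sech² ( (p-1)√ω/2 · |x| + artanh (γ/(2√ω)) ) ] ^ (1/(p-1))`. -/
def phi (p ω γ : ℝ) (x : ℝ) : ℝ :=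
  ((p + 1) * ω / 2 *
      (1 / Real.cosh ((p - 1) * √ω / 2 * |x| + Real.artanh (γ / (2 * √ω)))) ^ 2) ^
    (1 / (p - 1))

/-- `IsH1 f f'`: the function `f` is (the continuous representative of) an element of
`H¹(ℝ, ℝ)` and `f'` is (a representative of) its weak derivative, i.e. `f` and `f'` are square
integrable and `f` is the locally absolutely continuous function with derivative `f'`. -/
structure IsH1 (f f' : ℝ → ℝ) : Prop where
  memLp : MemLp f 2 volume
  memLp_deriv : MemLp f' 2 volume
  eq_integral : ∀ x, f x = f 0 + ∫ t in (0 : ℝ)..x, f' t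

/-- The bilinear form `∫ f'z' + ω ∫ fz - γ f(0)z(0) - ∫ V f z` of the operator
`-∂ₓ² + ω - γδ - V`, on pairs (function, derivative). -/
def form (ω γ : ℝ) (V : ℝ → ℝ) (f f' z z' : ℝ → ℝ) : ℝ :=
  (∫ x, f' x * z' x) + ω * (∫ x, f x * z x) - γ * (f 0 * z 0) - ∫ x, V x * f x * z x

/-- `v` lies in `H¹` and `w ∈ L²` represents the functional `z ↦ B(v, z)` on `H¹`. -/
def Represents (ω γ : ℝ) (V : ℝ → ℝ) (v w : L2R) : Prop :=
  ∃ f f' : ℝ → ℝ, IsH1 f f' ∧ v =ᵐ[volume] f ∧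
    ∀ z z' : ℝ → ℝ, IsH1 z z' → form ω γ V f f' z z' = ∫ x, w x * z x

theorem intervalIntegrable_of_memLp {f : ℝ → ℝ} (hf : MemLp f 2 volume) (a b : ℝ) :
    IntervalIntegrable f volume a b := by
  have h : LocallyIntegrable f volume := hf.locallyIntegrable (by norm_num)
  exact (h.integrableOn_isCompact isCompact_uIcc).intervalIntegrable

theorem IsH1.add {f f' g g' : ℝ → ℝ} (hf : IsH1 f f') (hg : IsH1 g g') :
    IsH1 (f + g) (f' + g') := by
  refine ⟨hf.memLp.add hg.memLp, hf.memLp_deriv.add hg.memLp_deriv, fun x => ?_⟩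
  have h1 : IntervalIntegrable f' volume 0 x :=
    intervalIntegrable_of_memLp hf.memLp_deriv 0 x
  have h2 : IntervalIntegrable g' volume 0 x :=
    intervalIntegrable_of_memLp hg.memLp_deriv 0 x
  simp only [Pi.add_apply]
  rw [intervalIntegral.integral_add h1 h2, hf.eq_integral x, hg.eq_integral x]
  ring

theorem IsH1.smul {f f' : ℝ → ℝ} (a : ℝ) (hf : IsH1 f f') : IsH1 (a • f) (a • f') := by
  refine ⟨hf.memLp.const_smul a, hf.memLp_deriv.const_smul a, fun x => ?_⟩
  simp only [Pi.smul_apply, smul_eq_mul]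
  rw [intervalIntegral.integral_const_mul, hf.eq_integral x]
  ring

theorem isH1_of_contDiff {g : ℝ → ℝ} (hg : ContDiff ℝ (⊤ : ℕ∞) g) (hc : HasCompactSupport g) :
    IsH1 g (deriv g) := by
  have hd : Continuous (deriv g) := hg.continuous_deriv (by simp)
  refine ⟨hg.continuous.memLp_of_hasCompactSupport hc,
    hd.memLp_of_hasCompactSupport hc.deriv, fun x => ?_⟩
  rw [intervalIntegral.integral_deriv_eq_sub
    (fun y _ => (hg.differentiable (by simp)).differentiableAt)
    (hd.intervalIntegrable _ _)]
  ring

theorem integrable_potential {V f z : ℝ → ℝ} (hV : Measurable V) (hb : ∃ C, ∀ x, |V x| ≤ C)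
    (hf : MemLp f 2 volume) (hz : MemLp z 2 volume) :
    Integrable (fun x => V x * f x * z x) := by
  obtain ⟨C, hC⟩ := hb
  have h : Integrable (fun x => f x * z x) := hf.integrable_mul hz
  have := h.bdd_mul (c := C) hV.aestronglyMeasurable (Filter.Eventually.of_forall hC)
  simpa [mul_assoc] using this

theorem form_add {ω γ : ℝ} {V : ℝ → ℝ} (hV : Measurable V) (hb : ∃ C, ∀ x, |V x| ≤ C)
    {f f' g g' z z' : ℝ → ℝ} (hf : IsH1 f f') (hg : IsH1 g g') (hz : IsH1 z z') :
    form ω γ V (f + g) (f' + g') z z' = form ω γ V f f' z z' + form ω γ V g g' z z' := by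
  have h1 : Integrable (fun x => f' x * z' x) := hf.memLp_deriv.integrable_mul hz.memLp_deriv
  have h2 : Integrable (fun x => g' x * z' x) := hg.memLp_deriv.integrable_mul hz.memLp_deriv
  have h3 : Integrable (fun x => f x * z x) := hf.memLp.integrable_mul hz.memLp
  have h4 : Integrable (fun x => g x * z x) := hg.memLp.integrable_mul hz.memLp
  have h5 := integrable_potential hV hb hf.memLp hz.memLp
  have h6 := integrable_potential hV hb hg.memLp hz.memLp
  simp only [form, Pi.add_apply, add_mul, mul_add]
  rw [integral_add h1 h2, integral_add h3 h4, integral_add h5 h6]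
  ring

theorem form_smul {ω γ : ℝ} {V : ℝ → ℝ} (a : ℝ) (f f' z z' : ℝ → ℝ) :
    form ω γ V (a • f) (a • f') z z' = a * form ω γ V f f' z z' := by
  have h : ∀ x, V x * (a * f x) * z x = a * (V x * f x * z x) := fun x => by ring
  simp only [form, Pi.smul_apply, smul_eq_mul, h, mul_assoc a, integral_const_mul]
  ring

theorem integrable_pair (w : L2R) {z : ℝ → ℝ} (hz : MemLp z 2 volume) :
    Integrable (fun x => w x * z x) :=
  (Lp.memLp w).integrable_mul hz

theorem represents_add {ω γ : ℝ} {V : ℝ → ℝ} (hV : Measurable V) (hb : ∃ C, ∀ x, |V x| ≤ C)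
    {v₁ v₂ w₁ w₂ : L2R} (h₁ : Represents ω γ V v₁ w₁) (h₂ : Represents ω γ V v₂ w₂) :
    Represents ω γ V (v₁ + v₂) (w₁ + w₂) := by
  obtain ⟨f, f', hf, hvf, hB⟩ := h₁
  obtain ⟨g, g', hg, hvg, hC⟩ := h₂
  refine ⟨f + g, f' + g', hf.add hg, (Lp.coeFn_add v₁ v₂).trans (hvf.add hvg), ?_⟩
  intro z z' hz
  rw [form_add hV hb hf hg hz, hB z z' hz, hC z z' hz,
    ← integral_add (integrable_pair w₁ hz.memLp) (integrable_pair w₂ hz.memLp)]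
  refine integral_congr_ae ?_
  filter_upwards [Lp.coeFn_add w₁ w₂] with x hx
  rw [hx, Pi.add_apply]
  ring

theorem represents_smul {ω γ : ℝ} {V : ℝ → ℝ} (a : ℝ) {v w : L2R}
    (h : Represents ω γ V v w) : Represents ω γ V (a • v) (a • w) := by
  obtain ⟨f, f', hf, hvf, hB⟩ := h
  refine ⟨a • f, a • f', hf.smul a, (Lp.coeFn_smul a v).trans (hvf.const_smul a), ?_⟩
  intro z z' hz
  rw [form_smul, hB z z' hz, ← integral_const_mul]
  refine integral_congr_ae ?_
  filter_upwards [Lp.coeFn_smul a w] with x hx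
  rw [hx, Pi.smul_apply, smul_eq_mul]
  ring

theorem represents_zero (ω γ : ℝ) (V : ℝ → ℝ) : Represents ω γ V 0 0 := by
  refine ⟨0, 0, ⟨MemLp.zero, MemLp.zero, by simp⟩, Lp.coeFn_zero _ _ _, ?_⟩
  intro z z' _
  have : ∫ x, (0 : L2R) x * z x = 0 := by
    rw [← integral_zero ℝ ℝ (μ := volume)]
    refine integral_congr_ae ?_
    filter_upwards [Lp.coeFn_zero ℝ 2 (volume : Measure ℝ)] with x hx
    rw [hx]
    simp
  rw [this]
  simp [form]

theorem represents_unique {ω γ : ℝ} {V : ℝ → ℝ} {v w₁ w₂ : L2R}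
    (h₁ : Represents ω γ V v w₁) (h₂ : Represents ω γ V v w₂) : w₁ = w₂ := by
  obtain ⟨f, f', hf, hvf, hB⟩ := h₁
  obtain ⟨g, g', hg, hvg, hC⟩ := h₂
  have hcont : ∀ {f f' : ℝ → ℝ}, IsH1 f f' → Continuous f := by
    intro f f' hf
    have : f = fun x => f 0 + ∫ t in (0 : ℝ)..x, f' t := funext hf.eq_integral
    rw [this]
    exact continuous_const.add (intervalIntegral.continuous_primitive
      (fun a b => intervalIntegrable_of_memLp hf.memLp_deriv a b) 0)
  have hfg : f = g :=
    (hcont hf).ae_eq_iff_eq volume (hcont hg) |>.1 (hvf.symm.trans hvg)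
  subst hfg
  -- the two derivatives agree almost everywhere
  have hl1 : LocallyIntegrable f' volume := hf.memLp_deriv.locallyIntegrable (by norm_num)
  have hl2 : LocallyIntegrable g' volume := hg.memLp_deriv.locallyIntegrable (by norm_num)
  have hder : f' =ᵐ[volume] g' := by
    filter_upwards [_root_.LocallyIntegrable.ae_hasDerivAt_integral hl1,
      _root_.LocallyIntegrable.ae_hasDerivAt_integral hl2] with x h1 h2
    have e : (fun u => ∫ t in (0 : ℝ)..u, f' t) = fun u => ∫ t in (0 : ℝ)..u, g' t := by
      funext u
      linarith [hf.eq_integral u, hg.eq_integral u]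
    have h1' := h1 0
    rw [e] at h1'
    exact h1'.unique (h2 0)
  have key : ∀ z z' : ℝ → ℝ, IsH1 z z' → ∫ x, (w₁ x - w₂ x) * z x = 0 := by
    intro z z' hz
    simp only [sub_mul]
    rw [integral_sub (integrable_pair w₁ hz.memLp) (integrable_pair w₂ hz.memLp),
      ← hB z z' hz, ← hC z z' hz]
    have : ∫ x, f' x * z' x = ∫ x, g' x * z' x :=
      integral_congr_ae (hder.mono fun x hx => by simp only [hx])
    simp only [form, this, sub_self]
  have hloc : LocallyIntegrable (fun x => w₁ x - w₂ x) volume :=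
    ((Lp.memLp w₁).sub (Lp.memLp w₂)).locallyIntegrable (by norm_num)
  have h0 := ae_eq_zero_of_integral_contDiff_smul_eq_zero hloc (fun g hg hc => by
    have := key g _ (isH1_of_contDiff hg hc)
    simpa [mul_comm] using this)
  refine Lp.ext ?_
  filter_upwards [h0] with x hx
  linarith

/-- The operator `-∂ₓ² + ω - γδ - V` in `L²(ℝ, ℝ)` defined by its form: its domain is the set of
all `v ∈ H¹` for which there is `w ∈ L²` with `B(v, z) = (w, z)` for all `z ∈ H¹`, and it sends
`v` to this (unique) `w`. -/
def formOperator (ω γ : ℝ) (V : ℝ → ℝ) (hV : Measurable V) (hb : ∃ C, ∀ x, |V x| ≤ C) :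
    L2R →ₗ.[ℝ] L2R where
  domain :=
    { carrier := {v | ∃ w, Represents ω γ V v w}
      add_mem' := fun ⟨_, h₁⟩ ⟨_, h₂⟩ => ⟨_, represents_add hV hb h₁ h₂⟩
      zero_mem' := ⟨0, represents_zero ω γ V⟩
      smul_mem' := fun a _ ⟨_, h⟩ => ⟨_, represents_smul a h⟩ }
  toFun :=
    { toFun := fun v => v.2.choose
      map_add' := fun v₁ v₂ => represents_unique (v₁ + v₂).2.choose_spec
        (represents_add hV hb v₁.2.choose_spec v₂.2.choose_spec)
      map_smul' := fun a v => represents_unique (a • v).2.choose_spec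
        (represents_smul a v.2.choose_spec) }

theorem measurable_phi_pow (p ω γ c : ℝ) : Measurable fun x => c * phi p ω γ x ^ (p - 1) := by
  unfold phi
  have : Measurable fun x : ℝ =>
      Real.cosh ((p - 1) * √ω / 2 * |x| + Real.artanh (γ / (2 * √ω))) :=
    (Real.continuous_cosh.comp (by fun_prop)).measurable
  fun_prop

theorem bounded_phi_pow {p ω γ : ℝ} (hp : 1 < p) (hω : γ ^ 2 / 4 < ω) (c : ℝ) :
    ∃ C, ∀ x, |c * phi p ω γ x ^ (p - 1)| ≤ C := by
  have hω0 : 0 < ω := lt_of_le_of_lt (by positivity) hω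
  refine ⟨|c| * ((p + 1) * ω / 2), fun x => ?_⟩
  rw [abs_mul]
  refine mul_le_mul_of_nonneg_left ?_ (abs_nonneg c)
  unfold phi
  have hA : 0 ≤ (p + 1) * ω / 2 := by
    have : 0 < p + 1 := by linarith
    positivity
  set y := (p - 1) * √ω / 2 * |x| + Real.artanh (γ / (2 * √ω))
  have hs : (1 / Real.cosh y) ^ 2 ≤ 1 := by
    have h1 := Real.one_le_cosh y
    have h2 : 0 ≤ 1 / Real.cosh y := by positivity
    have h3 : 1 / Real.cosh y ≤ 1 := by
      rw [div_le_one (by positivity)]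
      exact h1
    exact pow_le_one₀ h2 h3
  rw [← Real.rpow_mul (by positivity), one_div_mul_cancel (by linarith), Real.rpow_one,
    abs_of_nonneg (by positivity)]
  exact mul_le_of_le_one_right hA hs

/-- `L₁ = -∂ₓ² + ω - γδ - p φ^{p-1}` in `L²(ℝ, ℝ)`. -/
def opL₁ {p ω γ : ℝ} (hp : 1 < p) (hω : γ ^ 2 / 4 < ω) : L2R →ₗ.[ℝ] L2R :=
  formOperator ω γ (fun x => p * phi p ω γ x ^ (p - 1))
    (measurable_phi_pow p ω γ p) (bounded_phi_pow hp hω p)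

/-- `L₂ = -∂ₓ² + ω - γδ - φ^{p-1}` in `L²(ℝ, ℝ)`. -/
def opL₂ {p ω γ : ℝ} (hp : 1 < p) (hω : γ ^ 2 / 4 < ω) : L2R →ₗ.[ℝ] L2R :=
  formOperator ω γ (fun x => phi p ω γ x ^ (p - 1))
    (by simpa only [one_mul] using measurable_phi_pow p ω γ 1)
    (by simpa only [one_mul] using bounded_phi_pow hp hω 1)

/-- The real part `u ↦ u₁` from `L²(ℝ, ℂ)` to `L²(ℝ, ℝ)`. -/
def rePart : L2C →L[ℝ] L2R := Complex.reCLM.compLpL 2 volume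

/-- The imaginary part `u ↦ u₂` from `L²(ℝ, ℂ)` to `L²(ℝ, ℝ)`. -/
def imPart : L2C →L[ℝ] L2R := Complex.imCLM.compLpL 2 volume

/-- The inclusion of `L²(ℝ, ℝ)` in `L²(ℝ, ℂ)`. -/
def ofReal : L2R →L[ℝ] L2C := Complex.ofRealCLM.compLpL 2 volume

/-- The real-linear operator `H u = L₁ u₁ + i L₂ u₂` (where `u = u₁ + i u₂`) in `L²(ℝ, ℂ)`, with
domain the set of all `u` such that `u₁ ∈ D(L₁)` and `u₂ ∈ D(L₂)`. -/
def opH {p ω γ : ℝ} (hp : 1 < p) (hω : γ ^ 2 / 4 < ω) : L2C →ₗ.[ℝ] L2C where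
  domain := (opL₁ hp hω).domain.comap (rePart : L2C →ₗ[ℝ] L2R) ⊓
    (opL₂ hp hω).domain.comap (imPart : L2C →ₗ[ℝ] L2R)
  toFun :=
    { toFun := fun u => ofReal (opL₁ hp hω ⟨rePart u, u.2.1⟩) +
        Complex.I • ofReal (opL₂ hp hω ⟨imPart u, u.2.2⟩)
      map_add' := fun u v => by
        have h1 : (⟨rePart (u + v : _), (u + v).2.1⟩ : (opL₁ hp hω).domain) =
            ⟨rePart u, u.2.1⟩ + ⟨rePart v, v.2.1⟩ := Subtype.ext (map_add rePart _ _)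
        have h2 : (⟨imPart (u + v : _), (u + v).2.2⟩ : (opL₂ hp hω).domain) =
            ⟨imPart u, u.2.2⟩ + ⟨imPart v, v.2.2⟩ := Subtype.ext (map_add imPart _ _)
        simp only [Submodule.coe_add] at h1 h2 ⊢
        rw [h1, h2, LinearPMap.map_add, LinearPMap.map_add, map_add, map_add, smul_add]
        abel
      map_smul' := fun a u => by
        have h1 : (⟨rePart (a • u : _), (a • u).2.1⟩ : (opL₁ hp hω).domain) =
            a • ⟨rePart u, u.2.1⟩ := Subtype.ext (map_smul rePart _ _)
        have h2 : (⟨imPart (a • u : _), (a • u).2.2⟩ : (opL₂ hp hω).domain) =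
            a • ⟨imPart u, u.2.2⟩ := Subtype.ext (map_smul imPart _ _)
        simp only [Submodule.coe_smul] at h1 h2 ⊢
        rw [h1, h2, LinearPMap.map_smul, LinearPMap.map_smul, map_smul, map_smul,
          smul_comm Complex.I a, smul_add, RingHom.id_apply] }

section Spectrum

variable {E : Type*} [NormedAddCommGroup E] [NormedSpace ℝ E]

/-- The eigenspace `{x ∈ D(A) : A x = l x}` of an unbounded real-linear operator, for a real
number `l`. For `l = 0` it is the kernel of `A`. -/
def eigenspace (A : E →ₗ.[ℝ] E) (l : ℝ) : Submodule ℝ E :=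
  (LinearMap.ker (A.toFun - l • A.domain.subtype)).map A.domain.subtype

/-- The operator `A - z`, for `z = a + ib`, on the complexification of `E`, where a pair `(x, y)`
stands for `x + iy`:
`(A - z)(x + iy) = (A x - a x + b y) + i (A y - a y - b x)`. -/
def shiftedComplexification (A : E →ₗ.[ℝ] E) (z : ℂ) (x : A.domain × A.domain) : E × E :=
  (A x.1 - z.re • (x.1 : E) + z.im • (x.2 : E), A x.2 - z.re • (x.2 : E) - z.im • (x.1 : E))

/-- `z` is in the resolvent set of `A`: the operator `A - z` on the complexification is a
bijection from its domain onto the whole space and its inverse is bounded. -/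
def IsResolventPoint (A : E →ₗ.[ℝ] E) (z : ℂ) : Prop :=
  Function.Bijective (shiftedComplexification A z) ∧
    ∃ C : ℝ, ∀ x : A.domain × A.domain,
      ‖((x.1 : E), (x.2 : E))‖ ≤ C * ‖shiftedComplexification A z x‖

/-- The spectrum, a subset of `ℂ`, of an unbounded real-linear operator `A`. -/
def opSpectrum (A : E →ₗ.[ℝ] E) : Set ℂ := {z | ¬ IsResolventPoint A z}

/-- The set of negative eigenvalues of `A`. -/
def negEigenvalues (A : E →ₗ.[ℝ] E) : Set ℝ := {l | l < 0 ∧ eigenspace A l ≠ ⊥}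

end Spectrum

end DeltaNLS

end

/-! The operator $H$ is the orthogonal sum of $L_1$ and $L_2$, so everything reduces to symmetric
operators given by forms on $H^1(\mathbb{R})$.

Spectrum. The potentials $V_j$ are bounded and tend to $0$ at infinity. Take $f\in H^1$ vanishing on
a fine finite grid which contains $0$ and covers the region where $V_j>\omega/2$. The delta term
disappears, a Poincaré inequality on each cell lets $\int f'^2$ absorb $\int V_jf^2$ over the grid,
and outside $V_j\le\omega/2$; hence $B_j(f,f)\ge\frac{\omega}{2}\int f^2$ (`exists_finset_form_ge`).
So $H\ge\omega/2$ on a subspace of finite codimension of its domain. Below $\omega/2$ this leaves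
finitely many eigenvalues of finite multiplicity (`finite_eigenvalues_lt`,
`finiteDimensional_eigenspace`), and every other real number there is a resolvent point
(`isResolventPoint_of_not_eigenvalue`). This plays the role of Weyl's theorem on the essential
spectrum, without compactness. A first resolvent point, far to the left, comes from Lax-Milgram
(`exists_represents_sub`); with symmetry it also excludes nonreal spectrum
(`isResolventPoint_of_im_ne_zero`).

Kernels. On $x>0$ the profile agrees with a smooth $\Psi$ solving $\Psi''=(\omega-\Psi^{p-1})\Psi$,
and $\Psi'$ solves the linearised equation of $L_1$. For a decaying solution the form of the even
extension, tested with $z$, is a multiple of $z(0)$ (`IsDecayingSolution.form_comp_abs`). For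
$\Psi'$ and $L_1$ the factor is $(p-1)(\omega-\gamma^2/4)\Psi(0)\ne0$, so elements of $\ker L_1$
vanish at $0$; in $\ker L_2$ a multiple of $\varphi$ is subtracted to reach the same situation. A
kernel element vanishing at $0$ solves the ordinary differential equation on each half-line. Its
Wronskian with the decaying solution is constant and integrable, hence $0$; since the decaying
solution is nonzero at $0$, the kernel element has zero Cauchy data and vanishes
(`eq_zero_of_form_eq_zero`). For $L_1$ this needs $\Psi'(0)=-\frac{\gamma}{2}\Psi(0)\neq0$, that is
$\gamma\ne0$. -/

noncomputable section

namespace DeltaNLS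

/-! ### Spectral theory of symmetric operators bounded below on a subspace of finite codimension -/

section AbstractSpectrum

open scoped InnerProductSpace

variable {E : Type*} [NormedAddCommGroup E] [InnerProductSpace ℝ E]

/-- The real inner product makes `A` a symmetric operator. -/
def IsSymmetricOp (A : E →ₗ.[ℝ] E) : Prop :=
  ∀ x y : A.domain, ⟪A x, (y : E)⟫_ℝ = ⟪(x : E), A y⟫_ℝ

theorem mem_eigenspace_iff {A : E →ₗ.[ℝ] E} {l : ℝ} {x : E} :
    x ∈ eigenspace A l ↔ ∃ d : A.domain, A d = l • (d : E) ∧ (d : E) = x := by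
  unfold eigenspace
  simp only [Submodule.mem_map, LinearMap.mem_ker, LinearMap.sub_apply, LinearMap.smul_apply,
    Submodule.subtype_apply, sub_eq_zero]
  rfl

theorem eigenspace_eq_bot_iff {A : E →ₗ.[ℝ] E} {l : ℝ} :
    eigenspace A l = ⊥ ↔ ∀ d : A.domain, A d = l • (d : E) → d = 0 := by
  rw [Submodule.eq_bot_iff]
  refine ⟨fun h d hd => Subtype.ext (h _ (mem_eigenspace_iff.2 ⟨d, hd, rfl⟩)), ?_⟩
  rintro h x hx
  obtain ⟨d, hd, rfl⟩ := mem_eigenspace_iff.1 hx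
  simp [h d hd]

/-- A bounded symmetric injective operator which is bounded below on a subspace of finite
codimension is bijective. -/
theorem bijective_of_bounded_below_of_finite_codim [CompleteSpace E] {F : Type*}
    [AddCommGroup F] [Module ℝ F] [FiniteDimensional ℝ F] (S : E →L[ℝ] E)
    (hS : ∀ x y, ⟪S x, y⟫_ℝ = ⟪x, S y⟫_ℝ) (hinj : Function.Injective S)
    (ℓ : E →ₗ[ℝ] F) (C : ℝ) (hC : ∀ x, ℓ x = 0 → ‖x‖ ≤ C * ‖S x‖) :
    Function.Bijective S := by
  refine ⟨hinj, ?_⟩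
  -- `ℓ` need not be continuous (it will be built from point evaluations), so its kernel need not be
  -- closed; the lower bound passes to the closure.
  set W : Submodule ℝ E := (LinearMap.ker ℓ).topologicalClosure with hW
  have hWC : ∀ x ∈ W, ‖x‖ ≤ C * ‖S x‖ := by
    have hcl : IsClosed {x : E | ‖x‖ ≤ C * ‖S x‖} :=
      isClosed_le continuous_norm (continuous_const.mul S.continuous.norm)
    intro x hx
    exact closure_minimal (s := (LinearMap.ker ℓ : Set E)) (fun y hy => hC y hy) hcl hx
  have hWcl : IsClosed (W : Set E) := Submodule.isClosed_topologicalClosure _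
  have : CompleteSpace W := hWcl.completeSpace_coe
  have hanti : AntilipschitzWith (Real.toNNReal C) (S.comp W.subtypeL) := by
    refine ContinuousLinearMap.antilipschitz_of_bound _ fun x => ?_
    refine (hWC x x.2).trans ?_
    gcongr
    · exact Real.le_coe_toNNReal C
    · rfl
  have hclosed : IsClosed ((W.map (S : E →ₗ[ℝ] E) : Submodule ℝ E) : Set E) := by
    have h1 := hanti.isClosed_range (S.comp W.subtypeL).uniformContinuous
    convert h1 using 1
    ext y
    simp
  obtain ⟨W', hW'⟩ := W.exists_isCompl
  have : FiniteDimensional ℝ (E ⧸ LinearMap.ker ℓ) :=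
    LinearEquiv.finiteDimensional ℓ.quotKerEquivRange.symm
  have : FiniteDimensional ℝ (E ⧸ W) :=
    Module.Finite.of_surjective (Submodule.factor (Submodule.le_topologicalClosure (LinearMap.ker ℓ)))
      (Submodule.factor_surjective _)
  have : FiniteDimensional ℝ W' :=
    LinearEquiv.finiteDimensional (Submodule.quotientEquivOfIsCompl W W' hW')
  -- The range is the image of `W`, closed by the lower bound, plus a finite-dimensional space,
  -- hence closed.
  have hrange : LinearMap.range (S : E →ₗ[ℝ] E) =
      W.map (S : E →ₗ[ℝ] E) ⊔ W'.map (S : E →ₗ[ℝ] E) := by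
    rw [← Submodule.map_sup, hW'.sup_eq_top, Submodule.map_top]
  have hrcl : IsClosed ((LinearMap.range (S : E →ₗ[ℝ] E) : Submodule ℝ E) : Set E) := by
    rw [hrange]
    exact Submodule.isClosed_sup_finiteDimensional _ _ hclosed
  have := hrcl.completeSpace_coe
  -- By symmetry the orthogonal complement of the range is the kernel, which is trivial.
  have htop : LinearMap.range (S : E →ₗ[ℝ] E) = ⊤ := by
    rw [← Submodule.orthogonal_orthogonal (LinearMap.range (S : E →ₗ[ℝ] E)),
      Submodule.orthogonal_eq_top_iff, Submodule.eq_bot_iff]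
    intro x hx
    refine hinj ?_
    rw [map_zero, ← inner_self_eq_zero (𝕜 := ℝ)]
    rw [hS]
    rw [real_inner_comm]
    exact hx _ ⟨S x, rfl⟩
  exact LinearMap.range_eq_top.1 htop

/-- Data expressing that `A - s` has a bounded symmetric inverse `R` on the whole space. -/
structure HasResolvent (A : E →ₗ.[ℝ] E) (s : ℝ) where
  equiv : A.domain ≃ₗ[ℝ] E
  equiv_apply : ∀ x, equiv x = A x - s • (x : E)
  R : E →L[ℝ] E
  R_apply : ∀ w, R w = equiv.symm w
  norm_le : ∀ w, ‖R w‖ ≤ ‖w‖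
  symm : ∀ v w, ⟪R v, w⟫_ℝ = ⟪v, R w⟫_ℝ

/-- A symmetric operator with `A - s ≥ 1` and `A - s` surjective has a resolvent at `s`. -/
theorem nonempty_hasResolvent {A : E →ₗ.[ℝ] E} (hA : IsSymmetricOp A) (s : ℝ)
    (hlow : ∀ x : A.domain, (s + 1) * ‖(x : E)‖ ^ 2 ≤ ⟪A x, (x : E)⟫_ℝ)
    (hsurj : ∀ w, ∃ x : A.domain, A x - s • (x : E) = w) : Nonempty (HasResolvent A s) := by
  let G : A.domain →ₗ[ℝ] E := A.toFun - s • A.domain.subtype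
  have hG : ∀ x, G x = A x - s • (x : E) := fun x => rfl
  -- The assumption says $A-s\ge1$, so Cauchy-Schwarz gives the constant $1$.
  have hnorm : ∀ x : A.domain, ‖(x : E)‖ ≤ ‖G x‖ := by
    intro x
    have h1 : ‖(x : E)‖ ^ 2 ≤ ⟪G x, (x : E)⟫_ℝ := by
      rw [hG, inner_sub_left, real_inner_smul_left, real_inner_self_eq_norm_sq]
      linarith [hlow x]
    have h2 := real_inner_le_norm (G x) (x : E)
    rcases (norm_nonneg (x : E)).eq_or_lt with h | h
    · rw [← h]; positivity
    · nlinarith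
  have hinj : Function.Injective G := by
    rw [injective_iff_map_eq_zero]
    intro x hx
    have := hnorm x
    rw [hx, norm_zero] at this
    exact Subtype.ext (norm_le_zero_iff.1 this)
  let e : A.domain ≃ₗ[ℝ] E := LinearEquiv.ofBijective G ⟨hinj, hsurj⟩
  have he : ∀ x, e x = A x - s • (x : E) := fun x => rfl
  have hle : ∀ w, ‖((e.symm w : A.domain) : E)‖ ≤ ‖w‖ := fun w => by
    have := hnorm (e.symm w)
    rwa [show G (e.symm w) = w from e.apply_symm_apply w] at this
  refine ⟨⟨e, he, (A.domain.subtype ∘ₗ e.symm.toLinearMap).mkContinuous 1 (fun w => ?_),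
    fun w => rfl, fun w => hle w, fun v w => ?_⟩⟩
  · simpa using hle w
  · obtain ⟨x, rfl⟩ := e.surjective v
    obtain ⟨y, rfl⟩ := e.surjective w
    simp only [LinearMap.mkContinuous_apply, LinearMap.comp_apply, LinearEquiv.coe_coe,
      LinearEquiv.symm_apply_apply, Submodule.subtype_apply]
    simp only [he, inner_sub_left, inner_sub_right,
      real_inner_smul_left, real_inner_smul_right, hA x y]

theorem norm_fst_le_of_bound {A : E →ₗ.[ℝ] E} {z : ℂ} {C : ℝ}
    (hC : ∀ x : A.domain × A.domain, ‖(x.1 : E)‖ ≤ C * ‖shiftedComplexification A z x‖ ∧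
      ‖(x.2 : E)‖ ≤ C * ‖shiftedComplexification A z x‖) :
    ∃ C : ℝ, ∀ x : A.domain × A.domain,
      ‖((x.1 : E), (x.2 : E))‖ ≤ C * ‖shiftedComplexification A z x‖ :=
  ⟨C, fun x => by rw [Prod.norm_mk]; exact max_le (hC x).1 (hC x).2⟩

/-- Real points below `m` which are not eigenvalues are resolvent points, if `A ≥ m` on a subspace
of finite codimension. -/
theorem isResolventPoint_of_not_eigenvalue [CompleteSpace E] {F : Type*}
    [AddCommGroup F] [Module ℝ F] [FiniteDimensional ℝ F]
    {A : E →ₗ.[ℝ] E} {s : ℝ} (H : HasResolvent A s) (ℓ : A.domain →ₗ[ℝ] F) {m : ℝ}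
    (hm : ∀ x : A.domain, ℓ x = 0 → m * ‖(x : E)‖ ^ 2 ≤ ⟪A x, (x : E)⟫_ℝ)
    {z : ℂ} (hz : z.im = 0) (hzm : z.re < m) (he : eigenspace A z.re = ⊥) :
    IsResolventPoint A z := by
  set t := z.re with ht
  -- With $R=(A-s)^{-1}$ one has $A-t=S(A-s)$ for $S=1-(t-s)R$: inverting the unbounded $A-t$
  -- amounts to inverting the bounded symmetric $S$.
  let S : E →L[ℝ] E := ContinuousLinearMap.id ℝ E - (t - s) • H.R
  have hSapply : ∀ y, S y = y - (t - s) • H.R y := fun y => rfl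
  have hSG : ∀ x : A.domain, S (H.equiv x) = A x - t • (x : E) := by
    intro x
    rw [hSapply, H.R_apply, LinearEquiv.symm_apply_apply, H.equiv_apply]
    module
  have hSsymm : ∀ x y, ⟪S x, y⟫_ℝ = ⟪x, S y⟫_ℝ := by
    intro x y
    simp only [hSapply, inner_sub_left, inner_sub_right, real_inner_smul_left,
      real_inner_smul_right, H.symm]
  have hinj : Function.Injective S := by
    rw [injective_iff_map_eq_zero]
    intro y hy
    obtain ⟨x, rfl⟩ := H.equiv.surjective y
    rw [hSG, sub_eq_zero] at hy
    rw [eigenspace_eq_bot_iff.1 he x hy, map_zero]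
  have hmt : 0 < m - t := by linarith
  -- Write $y=(A-s)x$ with $\ell x=0$. Then $(m-t)\|x\|\le\|Sy\|$ because $A\ge m$ there, and
  -- $y=Sy+(t-s)x$.
  have hbelow : ∀ y, (ℓ ∘ₗ H.equiv.symm.toLinearMap) y = 0 →
      ‖y‖ ≤ (1 + |t - s| / (m - t)) * ‖S y‖ := by
    intro y hy
    obtain ⟨x, rfl⟩ := H.equiv.surjective y
    simp only [LinearMap.comp_apply, LinearEquiv.coe_coe, LinearEquiv.symm_apply_apply] at hy
    have h1 := hm x hy
    have h2 : (m - t) * ‖(x : E)‖ ^ 2 ≤ ⟪S (H.equiv x), (x : E)⟫_ℝ := by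
      rw [hSG, inner_sub_left, real_inner_smul_left, real_inner_self_eq_norm_sq]
      linarith
    have h3 := real_inner_le_norm (S (H.equiv x)) (x : E)
    have h4 : ‖(x : E)‖ ≤ ‖S (H.equiv x)‖ / (m - t) := by
      rw [le_div_iff₀ hmt]
      rcases (norm_nonneg (x : E)).eq_or_lt with h | h
      · rw [← h]; simp
      · nlinarith
    have h5 : H.equiv x = S (H.equiv x) + (t - s) • (x : E) := by
      rw [hSapply, H.R_apply, LinearEquiv.symm_apply_apply]
      abel
    calc ‖H.equiv x‖ = ‖S (H.equiv x) + (t - s) • (x : E)‖ := by rw [← h5]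
      _ ≤ ‖S (H.equiv x)‖ + |t - s| * ‖(x : E)‖ := by
        refine (norm_add_le _ _).trans ?_
        rw [norm_smul, Real.norm_eq_abs]
      _ ≤ ‖S (H.equiv x)‖ + |t - s| * (‖S (H.equiv x)‖ / (m - t)) := by gcongr
      _ = _ := by ring
  have hbij := bijective_of_bounded_below_of_finite_codim S hSsymm hinj _ _ hbelow
  let Se : E ≃L[ℝ] E := ContinuousLinearEquiv.ofBijective S (LinearMap.ker_eq_bot.2 hbij.1)
    (LinearMap.range_eq_top.2 hbij.2)
  have hSe : ∀ y, Se.symm (S y) = y := fun y => Se.symm_apply_apply y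
  -- For real $z$ the complexified operator acts separately on the two components.
  have hform : ∀ x : A.domain × A.domain, shiftedComplexification A z x =
      (S (H.equiv x.1), S (H.equiv x.2)) := by
    intro x
    simp only [shiftedComplexification, hz, zero_smul, add_zero, sub_zero, hSG, ht]
  refine ⟨⟨?_, ?_⟩, norm_fst_le_of_bound (C := ‖(Se.symm : E →L[ℝ] E)‖) fun x => ?_⟩
  · intro x y hxy
    rw [hform, hform, Prod.mk.injEq] at hxy
    exact Prod.ext (H.equiv.injective (hbij.1 hxy.1)) (H.equiv.injective (hbij.1 hxy.2))
  · rintro ⟨f, g⟩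
    obtain ⟨f', rfl⟩ := hbij.2 f
    obtain ⟨g', rfl⟩ := hbij.2 g
    exact ⟨(H.equiv.symm f', H.equiv.symm g'), by rw [hform]; simp⟩
  · have key : ∀ x : A.domain, ‖(x : E)‖ ≤ ‖(Se.symm : E →L[ℝ] E)‖ * ‖S (H.equiv x)‖ := by
      intro x
      have h1 := H.norm_le (H.equiv x)
      rw [H.R_apply, LinearEquiv.symm_apply_apply] at h1
      refine h1.trans ?_
      conv_lhs => rw [← hSe (H.equiv x)]
      exact (Se.symm : E →L[ℝ] E).le_opNorm _
    rw [hform, Prod.norm_mk]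
    exact ⟨(key _).trans (by gcongr; exact le_max_left _ _),
      (key _).trans (by gcongr; exact le_max_right _ _)⟩

/-- Nonreal points are resolvent points of a symmetric operator with a real resolvent point. -/
theorem isResolventPoint_of_im_ne_zero [CompleteSpace E] {A : E →ₗ.[ℝ] E}
    (hA : IsSymmetricOp A) {s : ℝ} (H : HasResolvent A s) {z : ℂ} (hz : z.im ≠ 0) :
    IsResolventPoint A z := by
  set a := z.re with ha
  set b := z.im with hb
  have hb2 : 0 < b ^ 2 := by positivity
  have hlin : ∀ x y : A.domain × A.domain, shiftedComplexification A z (x - y) =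
      shiftedComplexification A z x - shiftedComplexification A z y := by
    intro x y
    simp only [shiftedComplexification, Prod.fst_sub, Prod.snd_sub, LinearPMap.map_sub,
      Submodule.coe_sub, Prod.mk_sub_mk, Prod.mk.injEq]
    constructor <;> module
  -- Symmetry cancels the cross terms in
  -- $\|(A-z)(x+iy)\|^2=\|(A-a)x\|^2+\|(A-a)y\|^2+b^2(\|x\|^2+\|y\|^2)$. The factor 2 is the price
  -- of the maximum norm on the product.
  have hlow : ∀ x : A.domain × A.domain, b ^ 2 * (‖(x.1 : E)‖ ^ 2 + ‖(x.2 : E)‖ ^ 2) ≤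
      2 * ‖shiftedComplexification A z x‖ ^ 2 := by
    rintro ⟨x, y⟩
    have hsq : ∀ u v : E, ‖u + b • v‖ ^ 2 = ‖u‖ ^ 2 + 2 * b * ⟪u, v⟫_ℝ + b ^ 2 * ‖v‖ ^ 2 := by
      intro u v
      rw [norm_add_sq_real, real_inner_smul_right, norm_smul, mul_pow, Real.norm_eq_abs, sq_abs]
      ring
    have h1 : ‖(shiftedComplexification A z (x, y)).1‖ ^ 2 +
        ‖(shiftedComplexification A z (x, y)).2‖ ^ 2 = ‖A x - a • (x : E)‖ ^ 2 +
          ‖A y - a • (y : E)‖ ^ 2 + b ^ 2 * (‖(x : E)‖ ^ 2 + ‖(y : E)‖ ^ 2) := by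
      have e2 : (shiftedComplexification A z (x, y)).2 = (A y - a • (y : E)) + b • (-(x : E)) := by
        simp only [shiftedComplexification, ← ha, ← hb]; module
      have e1 : (shiftedComplexification A z (x, y)).1 = (A x - a • (x : E)) + b • (y : E) := rfl
      rw [e1, e2, hsq, hsq, norm_neg, inner_neg_right, inner_sub_left, inner_sub_left,
        real_inner_smul_left, real_inner_smul_left, hA x y, real_inner_comm (x : E) (A y),
        real_inner_comm (x : E) (y : E)]
      ring
    have h2 := norm_fst_le (shiftedComplexification A z (x, y))
    have h3 := norm_snd_le (shiftedComplexification A z (x, y))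
    have h4 := pow_le_pow_left₀ (norm_nonneg _) h2 2
    have h5 := pow_le_pow_left₀ (norm_nonneg _) h3 2
    simp only
    nlinarith [sq_nonneg ‖A x - a • (x : E)‖, sq_nonneg ‖A y - a • (y : E)‖]
  have hbd : ∀ x : A.domain × A.domain,
      ‖(x.1 : E)‖ ≤ 2 / |b| * ‖shiftedComplexification A z x‖ ∧
      ‖(x.2 : E)‖ ≤ 2 / |b| * ‖shiftedComplexification A z x‖ := by
    intro x
    have h := hlow x
    have hb' : 0 < |b| := abs_pos.2 hz
    rw [← sq_abs b] at h
    constructor <;>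
    · rw [div_mul_eq_mul_div, le_div_iff₀ hb']
      refine abs_le_of_sq_le_sq' ?_ (by positivity) |>.2
      nlinarith [sq_nonneg (|b| * ‖(x.1 : E)‖), sq_nonneg (|b| * ‖(x.2 : E)‖),
        sq_nonneg ‖shiftedComplexification A z x‖]
  refine ⟨⟨?_, ?_⟩, norm_fst_le_of_bound hbd⟩
  · intro x y hxy
    have h0 : shiftedComplexification A z (x - y) = 0 := by rw [hlin, hxy, sub_self]
    have h := hbd (x - y)
    rw [h0, norm_zero, mul_zero] at h
    refine sub_eq_zero.1 (Prod.ext (Subtype.ext ?_) (Subtype.ext ?_))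
    · exact norm_le_zero_iff.1 h.1
    · exact norm_le_zero_iff.1 h.2
  · set α := a - s with hα
    let R := H.R
    -- $Q=(A-z)(A-\bar z)R^2$, a real operator; inverting it solves the complex equation without
    -- complex scalars.
    let Q : E →L[ℝ] E := ContinuousLinearMap.id ℝ E - (2 * α) • R +
      (α ^ 2 + b ^ 2) • (R.comp R)
    have hQ : ∀ y, Q y = y - (2 * α) • R y + (α ^ 2 + b ^ 2) • R (R y) := fun y => rfl
    have hQsymm : ∀ x y, ⟪Q x, y⟫_ℝ = ⟪x, Q y⟫_ℝ := by
      intro x y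
      simp only [hQ, inner_sub_left, inner_sub_right, inner_add_left, inner_add_right,
        real_inner_smul_left, real_inner_smul_right, R, H.symm]
    have hpos : 0 < α ^ 2 + b ^ 2 := by positivity
    -- Completing the square: $(\alpha^2+b^2)\langle Qy,y\rangle=b^2\|y\|^2+\|\alpha
    -- y-(\alpha^2+b^2)Ry\|^2$.
    have hQlow : ∀ y, ‖y‖ ≤ ((α ^ 2 + b ^ 2) / b ^ 2) * ‖Q y‖ := by
      intro y
      have h1 : b ^ 2 * ‖y‖ ^ 2 ≤ (α ^ 2 + b ^ 2) * ⟪Q y, y⟫_ℝ := by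
        have h2 : ‖α • y - (α ^ 2 + b ^ 2) • R y‖ ^ 2 = α ^ 2 * ‖y‖ ^ 2
            - 2 * α * (α ^ 2 + b ^ 2) * ⟪R y, y⟫_ℝ + (α ^ 2 + b ^ 2) ^ 2 * ‖R y‖ ^ 2 := by
          rw [norm_sub_sq_real, norm_smul, norm_smul, mul_pow, mul_pow, real_inner_smul_left,
            real_inner_smul_right, Real.norm_eq_abs, Real.norm_eq_abs, sq_abs, sq_abs,
            real_inner_comm y (R y)]
          ring
        have h3 : ⟪Q y, y⟫_ℝ = ‖y‖ ^ 2 - 2 * α * ⟪R y, y⟫_ℝ + (α ^ 2 + b ^ 2) * ‖R y‖ ^ 2 := by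
          rw [hQ, inner_add_left, inner_sub_left, real_inner_smul_left, real_inner_smul_left,
            show ⟪R (R y), y⟫_ℝ = ⟪R y, R y⟫_ℝ from H.symm _ _, real_inner_self_eq_norm_sq,
            real_inner_self_eq_norm_sq]
        rw [h3]
        nlinarith [sq_nonneg ‖α • y - (α ^ 2 + b ^ 2) • R y‖]
      have h2 := real_inner_le_norm (Q y) y
      rw [div_mul_eq_mul_div, le_div_iff₀ hb2]
      rcases (norm_nonneg y).eq_or_lt with h | h
      · rw [← h]; simp only [zero_mul]; positivity
      · have : b ^ 2 * ‖y‖ ^ 2 ≤ (α ^ 2 + b ^ 2) * (‖Q y‖ * ‖y‖) :=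
          h1.trans (mul_le_mul_of_nonneg_left h2 hpos.le)
        nlinarith
    have hQinj : Function.Injective Q := by
      rw [injective_iff_map_eq_zero]
      intro y hy
      have := hQlow y
      rw [hy, norm_zero, mul_zero] at this
      exact norm_le_zero_iff.1 this
    have hQbij := bijective_of_bounded_below_of_finite_codim Q hQsymm hQinj
      (0 : E →ₗ[ℝ] ℝ) _ (fun y _ => hQlow y)
    rintro ⟨f, g⟩
    obtain ⟨f', rfl⟩ := hQbij.2 f
    obtain ⟨g', rfl⟩ := hQbij.2 g
    have hAR : ∀ y, A (H.equiv.symm y) = y + s • R y := by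
      intro y
      have h := H.equiv_apply (H.equiv.symm y)
      rw [LinearEquiv.apply_symm_apply, ← H.R_apply] at h
      rw [eq_comm, ← sub_eq_iff_eq_add.1 h.symm]
    have hRc : ∀ y, ((H.equiv.symm y : A.domain) : E) = R y := fun y => (H.R_apply y).symm
    -- The preimage of $Q(f'+ig')$ under $A-z$ is $(A-\bar
    -- z)R^2(f'+ig')=R\,(1-(\alpha-ib)R)(f'+ig')$.
    refine ⟨(H.equiv.symm (f' - α • R f' - b • R g'), H.equiv.symm (g' - α • R g' + b • R f')), ?_⟩
    simp only [shiftedComplexification, hAR, hRc]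
    simp only [← ha, ← hb, hQ, map_sub, map_add, map_smul, Prod.mk.injEq]
    rw [show a = α + s by rw [hα]; ring]
    constructor <;> module

/-- For a symmetric operator with `A ≥ m` on a subspace of finite codimension there are only
finitely many eigenvalues below `m`, of finite multiplicity. -/
theorem finite_eigenvalues_lt {F : Type*}
    [AddCommGroup F] [Module ℝ F] [FiniteDimensional ℝ F] {A : E →ₗ.[ℝ] E}
    (hA : IsSymmetricOp A) (ℓ : A.domain →ₗ[ℝ] F) {m : ℝ}
    (hm : ∀ x : A.domain, ℓ x = 0 → m * ‖(x : E)‖ ^ 2 ≤ ⟪A x, (x : E)⟫_ℝ) :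
    {l : ℝ | l < m ∧ eigenspace A l ≠ ⊥}.Finite := by
  set s := {l : ℝ | l < m ∧ eigenspace A l ≠ ⊥} with hs
  have hex : ∀ l : s, ∃ d : A.domain, A d = (l : ℝ) • (d : E) ∧ d ≠ 0 := by
    rintro ⟨l, hl⟩
    have := hl.2
    rw [Ne, eigenspace_eq_bot_iff] at this
    push Not at this
    exact this
  choose e heA he0 using hex
  have horth : ∀ i j : s, i ≠ j → ⟪(e i : E), (e j : E)⟫_ℝ = 0 := by
    intro i j hij
    have h := hA (e i) (e j)
    rw [heA, heA, real_inner_smul_left, real_inner_smul_right] at h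
    have h2 : ((i : ℝ) - j) * ⟪(e i : E), (e j : E)⟫_ℝ = 0 := by linarith
    exact (mul_eq_zero.1 h2).resolve_left (sub_ne_zero.2 fun h => hij (Subtype.ext h))
  -- The images under `ℓ` are independent, so there are at most $\dim F$ eigenvalues: a combination
  -- $x$ of the orthogonal eigenvectors with $\ell x=0$ satisfies $\langle Ax,x\rangle\ge m\|x\|^2$,
  -- yet all the eigenvalues lie strictly below $m$.
  have hli : LinearIndependent ℝ (fun l => ℓ (e l)) := by
    rw [linearIndependent_iff']
    intro T c hc i hi
    set x : A.domain := ∑ l ∈ T, c l • e l with hx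
    have hℓ : ℓ x = 0 := by rw [hx, map_sum]; simpa using hc
    have hxE : (x : E) = ∑ l ∈ T, c l • (e l : E) := by simp [hx]
    have hAx : A x = ∑ l ∈ T, (l : ℝ) • c l • (e l : E) := by
      have : A.toFun x = ∑ l ∈ T, c l • A.toFun (e l) := by simp [hx]
      change A.toFun x = _
      rw [this]
      refine Finset.sum_congr rfl fun l _ => ?_
      rw [show A.toFun (e l) = (l : ℝ) • (e l : E) from heA l, smul_comm]
    have hin : ∀ d : s → ℝ, ⟪∑ l ∈ T, d l • (e l : E), (x : E)⟫_ℝ =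
        ∑ l ∈ T, d l * c l * ‖(e l : E)‖ ^ 2 := by
      intro d
      rw [hxE, sum_inner]
      refine Finset.sum_congr rfl fun l hl => ?_
      rw [inner_sum, Finset.sum_eq_single l]
      · rw [real_inner_smul_left, real_inner_smul_right, real_inner_self_eq_norm_sq]; ring
      · intro j _ hj
        rw [real_inner_smul_left, real_inner_smul_right, horth l j hj.symm]; ring
      · exact fun h => absurd hl h
    have h1 := hm x hℓ
    have h2 : ⟪A x, (x : E)⟫_ℝ = ∑ l ∈ T, ((l : ℝ) * c l) * c l * ‖(e l : E)‖ ^ 2 := by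
      rw [hAx, ← hin fun l => (l : ℝ) * c l]
      simp only [smul_smul]
    have h3 : ‖(x : E)‖ ^ 2 = ∑ l ∈ T, c l * c l * ‖(e l : E)‖ ^ 2 := by
      rw [← hin c, ← hxE, real_inner_self_eq_norm_sq]
    rw [h2, h3, Finset.mul_sum, ← sub_nonneg, ← Finset.sum_sub_distrib] at h1
    have hterm : ∀ l ∈ T, (l : ℝ) * c l * c l * ‖(e l : E)‖ ^ 2
        - m * (c l * c l * ‖(e l : E)‖ ^ 2) ≤ 0 := by
      intro l _
      have h5 : (l : ℝ) < m := l.2.1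
      have h6 : 0 ≤ c l * c l * ‖(e l : E)‖ ^ 2 :=
        mul_nonneg (mul_self_nonneg _) (sq_nonneg _)
      nlinarith
    have h4 := (Finset.sum_eq_zero_iff_of_nonpos hterm).1
      (le_antisymm (Finset.sum_nonpos hterm) h1) i hi
    have h5 : ((i : ℝ) - m) * (c i * c i * ‖(e i : E)‖ ^ 2) = 0 := by linarith
    have h6 : (i : ℝ) - m ≠ 0 := (sub_neg.2 i.2.1).ne
    have h7 : ‖(e i : E)‖ ^ 2 ≠ 0 := by
      have : (e i : E) ≠ 0 := fun h => he0 i (Subtype.ext h)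
      positivity
    simpa [h6, h7] using h5
  have : Finite s := hli.finite
  exact Set.toFinite s

/-- `ℓ` is injective on the eigenspace: if $Ax=lx$ and $\ell x=0$, then $m\|x\|^2\le l\|x\|^2$ with
$l<m$. -/
theorem finiteDimensional_eigenspace {F : Type*}
    [AddCommGroup F] [Module ℝ F] [FiniteDimensional ℝ F] {A : E →ₗ.[ℝ] E}
    (ℓ : A.domain →ₗ[ℝ] F) {m : ℝ}
    (hm : ∀ x : A.domain, ℓ x = 0 → m * ‖(x : E)‖ ^ 2 ≤ ⟪A x, (x : E)⟫_ℝ)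
    {l : ℝ} (hl : l < m) : FiniteDimensional ℝ (eigenspace A l) := by
  set K := LinearMap.ker (A.toFun - l • A.domain.subtype) with hK
  have hinj : Function.Injective (ℓ ∘ₗ K.subtype) := by
    rw [injective_iff_map_eq_zero]
    rintro ⟨x, hx⟩ h
    have h1 := hm x h
    have h2 : A x = l • (x : E) := sub_eq_zero.1 (LinearMap.mem_ker.1 hx)
    rw [h2, real_inner_smul_left, real_inner_self_eq_norm_sq] at h1
    have h3 : ‖(x : E)‖ ^ 2 = 0 := le_antisymm (by nlinarith [sq_nonneg ‖(x : E)‖]) (sq_nonneg _)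
    have h4 : (x : E) = 0 := by simpa using h3
    exact Subtype.ext (Subtype.ext h4)
  have : FiniteDimensional ℝ K := FiniteDimensional.of_injective _ hinj
  exact Module.Finite.map K _

/-- The spectrum away from the eigenvalues below some `m > 0` is positive. -/
theorem exists_spectral_gap [CompleteSpace E] {F : Type*}
    [AddCommGroup F] [Module ℝ F] [FiniteDimensional ℝ F] {A : E →ₗ.[ℝ] E}
    (hA : IsSymmetricOp A) {s : ℝ} (H : HasResolvent A s) (ℓ : A.domain →ₗ[ℝ] F) {m : ℝ}
    (hm0 : 0 < m)
    (hm : ∀ x : A.domain, ℓ x = 0 → m * ‖(x : E)‖ ^ 2 ≤ ⟪A x, (x : E)⟫_ℝ) :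
    ∃ δ : ℝ, 0 < δ ∧ ∀ z ∈ opSpectrum A \
      ((fun l : ℝ => (l : ℂ)) '' (negEigenvalues A ∪ {0})), z.im = 0 ∧ δ ≤ z.re := by
  have hfin := finite_eigenvalues_lt hA ℓ hm
  -- The gap is the least positive eigenvalue below $m$; including $m$ keeps the set nonempty and
  -- covers the spectrum from $m$ on.
  set P : Set ℝ := insert m ({l : ℝ | l < m ∧ eigenspace A l ≠ ⊥} ∩ Set.Ioi 0) with hP
  have hPfin : P.Finite := (hfin.inter_of_left _).insert m
  obtain ⟨δ, hδP, hδ⟩ := Set.exists_min_image P id hPfin ⟨m, Set.mem_insert _ _⟩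
  refine ⟨δ, ?_, ?_⟩
  · rcases hδP with rfl | h
    · exact hm0
    · exact h.2
  · rintro z ⟨hz, hz'⟩
    have him : z.im = 0 := by
      by_contra h
      exact hz (isResolventPoint_of_im_ne_zero hA H h)
    refine ⟨him, ?_⟩
    by_cases hzm : z.re < m
    · have he : eigenspace A z.re ≠ ⊥ := fun he =>
        hz (isResolventPoint_of_not_eigenvalue H ℓ hm him hzm he)
      have hzr : ((z.re : ℝ) : ℂ) = z := Complex.ext rfl (by simp [him])
      have hpos : 0 < z.re := by
        by_contra hneg
        refine hz' ⟨z.re, ?_, hzr⟩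
        rcases (not_lt.1 hneg).lt_or_eq with h | h
        · exact Or.inl ⟨h, he⟩
        · exact Or.inr h
      exact hδ _ (Or.inr ⟨⟨hzm, he⟩, hpos⟩)
    · exact (hδ m (Or.inl rfl)).trans (not_lt.1 hzm)

end AbstractSpectrum

/-! ### Trace inequality and coercivity of the form -/

section SobolevEstimates

theorem IsH1.continuous {f f' : ℝ → ℝ} (hf : IsH1 f f') : Continuous f := by
  have : f = fun x => f 0 + ∫ t in (0 : ℝ)..x, f' t := funext hf.eq_integral
  rw [this]
  exact continuous_const.add (intervalIntegral.continuous_primitive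
    (fun a b => intervalIntegrable_of_memLp hf.memLp_deriv a b) 0)

theorem IsH1.congr_deriv {f f' g' : ℝ → ℝ} (hf : IsH1 f f') (h : f' =ᵐ[volume] g') :
    IsH1 f g' := by
  refine ⟨hf.memLp, hf.memLp_deriv.ae_eq h, fun x => ?_⟩
  rw [hf.eq_integral x, intervalIntegral.integral_congr_ae (h.mono fun t ht _ => ht)]

theorem IsH1.sub_eq_integral {f f' : ℝ → ℝ} (hf : IsH1 f f') (a b : ℝ) :
    f b - f a = ∫ t in a..b, f' t := by
  rw [hf.eq_integral a, hf.eq_integral b, add_sub_add_left_eq_sub,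
    intervalIntegral.integral_interval_sub_left] <;>
  exact intervalIntegrable_of_memLp hf.memLp_deriv _ _

theorem integrable_mul_self {f : ℝ → ℝ} (hf : MemLp f 2 volume) :
    Integrable fun x => f x * f x :=
  hf.integrable_mul hf

theorem intervalIntegral_mul_self_le {f : ℝ → ℝ} (hf : MemLp f 2 volume) {a b : ℝ}
    (hab : a ≤ b) : ∫ t in a..b, f t * f t ≤ ∫ t, f t * f t := by
  rw [intervalIntegral.integral_of_le hab]
  exact setIntegral_le_integral (integrable_mul_self hf)
    (Filter.Eventually.of_forall fun x => mul_self_nonneg (f x))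

/-- Cauchy-Schwarz, obtained by expanding $\int(f'-c)^2\ge0$ with $c$ the mean slope. -/
theorem IsH1.sq_sub_le {f f' : ℝ → ℝ} (hf : IsH1 f f') {a b : ℝ} (hab : a ≤ b) :
    (f b - f a) ^ 2 ≤ (b - a) * ∫ t in a..b, f' t * f' t := by
  rcases hab.eq_or_lt with rfl | hlt
  · simp
  have hh : 0 < b - a := sub_pos.2 hlt
  have h1 : IntervalIntegrable f' volume a b := intervalIntegrable_of_memLp hf.memLp_deriv a b
  have h2 : IntervalIntegrable (fun t => f' t * f' t) volume a b :=
    (integrable_mul_self hf.memLp_deriv).intervalIntegrable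
  set c := (f b - f a) / (b - a) with hc
  have h3 : 0 ≤ ∫ t in a..b, (f' t - c) * (f' t - c) :=
    intervalIntegral.integral_nonneg hab fun t _ => mul_self_nonneg _
  have h4 : ∀ t, (f' t - c) * (f' t - c) = f' t * f' t - (2 * c) * f' t + c ^ 2 := fun t => by ring
  simp only [h4] at h3
  rw [intervalIntegral.integral_add (h2.sub (h1.const_mul _)) (by simp),
    intervalIntegral.integral_sub h2 (h1.const_mul _), intervalIntegral.integral_const_mul,
    ← hf.sub_eq_integral, intervalIntegral.integral_const, smul_eq_mul] at h3
  have h5 : c * (b - a) = f b - f a := by rw [hc]; field_simp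
  have h6 : (b - a) * (2 * c * (f b - f a)) = 2 * (f b - f a) ^ 2 := by rw [← h5]; ring
  have h7 : (b - a) * ((b - a) * c ^ 2) = (f b - f a) ^ 2 := by rw [← h5]; ring
  nlinarith [mul_nonneg hh.le h3]

/-- The trace inequality for `H¹` functions. -/
theorem IsH1.sq_apply_zero_le {f f' : ℝ → ℝ} (hf : IsH1 f f') {h : ℝ} (hh : 0 < h) :
    f 0 ^ 2 ≤ 2 / h * (∫ x, f x * f x) + 2 * h * ∫ x, f' x * f' x := by
  set D := ∫ x, f' x * f' x with hD
  -- From $f(0)^2\le2f(t)^2+2(f(t)-f(0))^2$; the trace inequality is its average over $t\in[0,h]$.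
  have hpt : ∀ t ∈ Set.Icc 0 h, f 0 ^ 2 ≤ 2 * (f t * f t) + 2 * h * D := by
    intro t ht
    have h1 := hf.sq_sub_le ht.1
    have h2 := intervalIntegral_mul_self_le hf.memLp_deriv ht.1
    have h0 : 0 ≤ ∫ s in (0 : ℝ)..t, f' s * f' s :=
      intervalIntegral.integral_nonneg ht.1 fun t _ => mul_self_nonneg _
    have h3 : (t - 0) * ∫ s in (0 : ℝ)..t, f' s * f' s ≤ h * D := by
      rw [sub_zero]
      exact mul_le_mul ht.2 h2 h0 hh.le
    nlinarith [sq_nonneg (f t + (f t - f 0))]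
  have hint : IntervalIntegrable (fun t => f t * f t) volume 0 h :=
    (integrable_mul_self hf.memLp).intervalIntegrable
  have h1 := intervalIntegral.integral_mono_on hh.le (by simp)
    ((hint.const_mul 2).add (by simp : IntervalIntegrable (fun _ => 2 * h * D) volume 0 h)) hpt
  rw [intervalIntegral.integral_add (hint.const_mul 2) (by simp),
    intervalIntegral.integral_const_mul, intervalIntegral.integral_const,
    intervalIntegral.integral_const, smul_eq_mul, smul_eq_mul, sub_zero] at h1
  have h2 := intervalIntegral_mul_self_le hf.memLp hh.le
  have h3 : f 0 ^ 2 * h ≤ (2 / h * (∫ x, f x * f x) + 2 * h * D) * h := by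
    have : 2 / h * (∫ x, f x * f x) * h = 2 * ∫ x, f x * f x := by field_simp
    rw [add_mul, this]
    linarith
  exact le_of_mul_le_mul_right h3 hh

theorem form_symm (ω γ : ℝ) (V : ℝ → ℝ) (f f' z z' : ℝ → ℝ) :
    form ω γ V f f' z z' = form ω γ V z z' f f' := by
  simp only [form, mul_comm (f' _), mul_comm (f _), mul_right_comm (V _) (f _)]

/-- Derivatives matter only up to null sets, whereas the functions themselves are kept pointwise for
the sake of the value at the origin. -/
theorem form_congr {ω γ : ℝ} {V : ℝ → ℝ} {f f' g' z z' y' : ℝ → ℝ}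
    (h : f' =ᵐ[volume] g') (h2 : z' =ᵐ[volume] y') :
    form ω γ V f f' z z' = form ω γ V f g' z y' := by
  have : ∫ x, f' x * z' x = ∫ x, g' x * y' x := by
    refine integral_congr_ae ?_
    filter_upwards [h, h2] with x h1 h2
    rw [h1, h2]
  simp only [form, this]

theorem form_shift {ω γ s : ℝ} {V : ℝ → ℝ} (f f' z z' : ℝ → ℝ) :
    form (ω - s) γ V f f' z z' = form ω γ V f f' z z' - s * ∫ x, f x * z x := by
  simp only [form]; ring

theorem integral_potential_le {V f : ℝ → ℝ} {M : ℝ} (hV : Measurable V) (hM : ∀ x, |V x| ≤ M)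
    (hf : MemLp f 2 volume) : ∫ x, V x * f x * f x ≤ M * ∫ x, f x * f x := by
  rw [← integral_const_mul]
  refine integral_mono (integrable_potential hV ⟨M, hM⟩ hf hf)
    ((integrable_mul_self hf).const_mul M) fun x => ?_
  simp only [mul_assoc]
  exact mul_le_mul_of_nonneg_right ((le_abs_self _).trans (hM x)) (mul_self_nonneg _)

/-- The form is coercive after a large shift. -/
theorem form_coercive {σ γ M : ℝ} {V : ℝ → ℝ} (hV : Measurable V) (hM : ∀ x, |V x| ≤ M)
    (hσ : M + 8 * (|γ| + 1) ^ 2 + 1 ≤ σ) {f f' : ℝ → ℝ} (hf : IsH1 f f') :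
    (∫ x, f' x * f' x) / 2 + ∫ x, f x * f x ≤ form σ γ V f f' f f' := by
  -- This $h$ makes the delta term cost at most half of $\int f'^2$; the price is
  -- $8(|\gamma|+1)^2\int f^2$, which the size of `σ` pays for.
  have h1 := hf.sq_apply_zero_le (h := 1 / (4 * (|γ| + 1))) (by positivity)
  have h2 := integral_potential_le hV hM hf.memLp
  have hD : 0 ≤ ∫ x, f' x * f' x := integral_nonneg fun x => mul_self_nonneg _
  have hI : 0 ≤ ∫ x, f x * f x := integral_nonneg fun x => mul_self_nonneg _
  simp only [form]
  set D := ∫ x, f' x * f' x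
  set I := ∫ x, f x * f x
  have hg : 0 < |γ| + 1 := by positivity
  have e1 : 2 / (1 / (4 * (|γ| + 1))) = 8 * (|γ| + 1) := by field_simp; ring
  have e2 : 2 * (1 / (4 * (|γ| + 1))) = 1 / (2 * (|γ| + 1)) := by field_simp; ring
  rw [e1, e2] at h1
  have h3 : γ * (f 0 * f 0) ≤ (|γ| + 1) * f 0 ^ 2 := by
    nlinarith [le_abs_self γ, sq_nonneg (f 0)]
  have h4 : (|γ| + 1) * f 0 ^ 2 ≤ 8 * (|γ| + 1) ^ 2 * I + D / 2 := by
    refine (mul_le_mul_of_nonneg_left h1 hg.le).trans (le_of_eq ?_)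
    field_simp
  nlinarith [mul_le_mul_of_nonneg_right hσ hI]

end SobolevEstimates

/-! ### The Hilbert space $H^1$ and solvability by Lax-Milgram -/

section SobolevSpace

open scoped InnerProductSpace

theorem inner_eq_integral {u v : L2R} {f g : ℝ → ℝ} (hu : u =ᵐ[volume] f)
    (hv : v =ᵐ[volume] g) : ⟪u, v⟫_ℝ = ∫ x, f x * g x := by
  rw [L2.inner_def]
  refine integral_congr_ae ?_
  filter_upwards [hu, hv] with x h1 h2
  simp only [h1, h2, RCLike.inner_apply, conj_trivial]
  ring

theorem norm_sq_eq_integral {u : L2R} {f : ℝ → ℝ} (hu : u =ᵐ[volume] f) :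
    ‖u‖ ^ 2 = ∫ x, f x * f x := by
  rw [← real_inner_self_eq_norm_sq, inner_eq_integral hu hu]

/-- The Sobolev space `H¹(ℝ, ℝ)`, as a space of pairs (function, weak derivative). -/
def H1 : Submodule ℝ (WithLp 2 (L2R × L2R)) where
  carrier := {u | ∃ f : ℝ → ℝ, IsH1 f u.snd ∧ u.fst =ᵐ[volume] f}
  add_mem' := by
    rintro u v ⟨f, hf, huf⟩ ⟨g, hg, hvg⟩
    exact ⟨f + g, (hf.add hg).congr_deriv (Lp.coeFn_add u.snd v.snd).symm,
      (Lp.coeFn_add u.fst v.fst).trans (huf.add hvg)⟩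
  zero_mem' := ⟨0, IsH1.congr_deriv (f' := 0) ⟨MemLp.zero, MemLp.zero, by simp⟩
    (Lp.coeFn_zero ℝ 2 (volume : Measure ℝ)).symm, Lp.coeFn_zero ℝ 2 (volume : Measure ℝ)⟩
  smul_mem' := by
    rintro a u ⟨f, hf, huf⟩
    exact ⟨a • f, (hf.smul a).congr_deriv (Lp.coeFn_smul a u.snd).symm,
      (Lp.coeFn_smul a u.fst).trans (huf.const_smul a)⟩

namespace H1

/-- The continuous representative of an element of `H¹`. -/
def rep (u : H1) : ℝ → ℝ := u.2.choose

/-- The underlying square integrable function. -/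
def val (u : H1) : L2R := (u : WithLp 2 (L2R × L2R)).fst

/-- The weak derivative. -/
def der (u : H1) : L2R := (u : WithLp 2 (L2R × L2R)).snd

theorem isH1_rep (u : H1) : IsH1 (rep u) (der u) := u.2.choose_spec.1

theorem val_ae_eq (u : H1) : val u =ᵐ[volume] rep u := u.2.choose_spec.2

theorem rep_unique {u : H1} {f f' : ℝ → ℝ} (hf : IsH1 f f') (h : val u =ᵐ[volume] f) :
    rep u = f :=
  ((isH1_rep u).continuous.ae_eq_iff_eq volume hf.continuous).1 ((val_ae_eq u).symm.trans h)

theorem rep_add (u v : H1) : rep (u + v) = rep u + rep v :=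
  rep_unique ((isH1_rep u).add (isH1_rep v))
    ((Lp.coeFn_add (val u) (val v)).trans ((val_ae_eq u).add (val_ae_eq v)))

theorem rep_smul (a : ℝ) (u : H1) : rep (a • u) = a • rep u :=
  rep_unique ((isH1_rep u).smul a)
    ((Lp.coeFn_smul a (val u)).trans ((val_ae_eq u).const_smul a))

theorem norm_sq (u : H1) : ‖u‖ ^ 2 = ‖val u‖ ^ 2 + ‖der u‖ ^ 2 := by
  exact WithLp.prod_norm_sq_eq_of_L2 (u : WithLp 2 (L2R × L2R))

theorem norm_val_le (u : H1) : ‖val u‖ ≤ ‖u‖ := by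
  refine abs_le_of_sq_le_sq' ?_ (norm_nonneg _) |>.2
  rw [norm_sq]
  linarith [sq_nonneg ‖der u‖]

theorem norm_der_le (u : H1) : ‖der u‖ ≤ ‖u‖ := by
  refine abs_le_of_sq_le_sq' ?_ (norm_nonneg _) |>.2
  rw [norm_sq]
  linarith [sq_nonneg ‖val u‖]

/-- The element of `H¹` given by a function and its derivative. -/
def mk {f f' : ℝ → ℝ} (hf : IsH1 f f') : H1 :=
  ⟨WithLp.toLp 2 (hf.memLp.toLp, hf.memLp_deriv.toLp), f,
    hf.congr_deriv hf.memLp_deriv.coeFn_toLp.symm, hf.memLp.coeFn_toLp⟩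

theorem rep_mk {f f' : ℝ → ℝ} (hf : IsH1 f f') : rep (mk hf) = f :=
  rep_unique hf hf.memLp.coeFn_toLp

theorem der_mk {f f' : ℝ → ℝ} (hf : IsH1 f f') : der (mk hf) =ᵐ[volume] f' :=
  hf.memLp_deriv.coeFn_toLp

theorem val_mk {f f' : ℝ → ℝ} (hf : IsH1 f f') : val (mk hf) =ᵐ[volume] f :=
  hf.memLp.coeFn_toLp

/-- Evaluation at the origin. -/
def eval₀ : H1 →L[ℝ] ℝ :=
  LinearMap.mkContinuous
    { toFun := fun u => rep u 0
      map_add' := fun u v => by rw [rep_add]; rfl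
      map_smul' := fun a u => by rw [rep_smul]; rfl } 2 (fun u => by
    have h := (isH1_rep u).sq_apply_zero_le one_pos
    rw [← norm_sq_eq_integral (val_ae_eq u), ← norm_sq_eq_integral (Filter.EventuallyEq.rfl)] at h
    refine abs_le_of_sq_le_sq ?_ (by positivity)
    rw [mul_pow, norm_sq]
    simp only [LinearMap.coe_mk, AddHom.coe_mk]
    nlinarith [sq_nonneg ‖val u‖, sq_nonneg ‖der u‖])

/-- Integration over a bounded interval is the $L^2$ pairing with its indicator, hence continuous.
-/
theorem tendsto_intervalIntegral {u : ℕ → L2R} {v : L2R}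
    (h : Filter.Tendsto u Filter.atTop (nhds v)) (x : ℝ) :
    Filter.Tendsto (fun n => ∫ t in (0 : ℝ)..x, u n t) Filter.atTop
      (nhds (∫ t in (0 : ℝ)..x, v t)) := by
  have key : ∀ a b : ℝ, Filter.Tendsto (fun n => ∫ t in Set.Ioc a b, u n t) Filter.atTop
      (nhds (∫ t in Set.Ioc a b, v t)) := by
    intro a b
    have hfin : volume (Set.Ioc a b) ≠ ⊤ := measure_Ioc_lt_top.ne
    simp only [← L2.inner_indicatorConstLp_one (𝕜 := ℝ) measurableSet_Ioc hfin]
    exact Filter.Tendsto.inner tendsto_const_nhds h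
  simp only [intervalIntegral]
  exact (key 0 x).sub (key x 0)

/-- $H^1$ is closed in $L^2\times L^2$: the values at $0$ and the integrals of the derivatives
converge, so the representatives converge pointwise to a primitive of the limit derivative. A
subsequence converging almost everywhere identifies this with the $L^2$ limit. -/
instance : CompleteSpace H1 := by
  suffices h : IsClosed (H1 : Set (WithLp 2 (L2R × L2R))) from h.completeSpace_coe
  rw [← isSeqClosed_iff_isClosed]
  intro u v hu huv
  let U : ℕ → H1 := fun n => ⟨u n, hu n⟩
  have hfst : Filter.Tendsto (fun n => val (U n)) Filter.atTop (nhds v.fst) :=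
    ((WithLp.continuous_fst 2 L2R L2R).tendsto v).comp huv
  have hsnd : Filter.Tendsto (fun n => der (U n)) Filter.atTop (nhds v.snd) :=
    ((WithLp.continuous_snd 2 L2R L2R).tendsto v).comp huv
  have hU : CauchySeq U := by
    have h1 : CauchySeq (fun n => (U n : WithLp 2 (L2R × L2R))) := huv.cauchySeq
    rw [Metric.cauchySeq_iff] at h1 ⊢
    exact h1
  obtain ⟨c, hc⟩ := cauchySeq_tendsto_of_complete (eval₀.uniformContinuous.comp_cauchySeq hU)
  set f : ℝ → ℝ := fun x => c + ∫ t in (0 : ℝ)..x, v.snd t with hf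
  have hlim : ∀ x, Filter.Tendsto (fun n => rep (U n) x) Filter.atTop (nhds (f x)) := by
    intro x
    have h1 : (fun n => rep (U n) x) =
        fun n => eval₀ (U n) + ∫ t in (0 : ℝ)..x, der (U n) t :=
      funext fun n => (isH1_rep (U n)).eq_integral x
    rw [h1]
    exact hc.add (tendsto_intervalIntegral hsnd x)
  obtain ⟨ns, hns, hae⟩ := (tendstoInMeasure_of_tendsto_Lp hfst).exists_seq_tendsto_ae
  have hvf : v.fst =ᵐ[volume] f := by
    have hall : ∀ᵐ x, ∀ n, val (U n) x = rep (U n) x := ae_all_iff.2 fun n => val_ae_eq (U n)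
    filter_upwards [hae, hall] with x h1 h2
    simp only [h2] at h1
    exact tendsto_nhds_unique h1 ((hlim x).comp hns.tendsto_atTop)
  exact ⟨f, ⟨(Lp.memLp v.fst).ae_eq hvf, Lp.memLp v.snd, fun x => by simp [hf]⟩, hvf⟩

theorem abs_integral_potential_le {V : ℝ → ℝ} {M : ℝ} (hV : Measurable V)
    (hM : ∀ x, |V x| ≤ M) (u v : H1) :
    |∫ x, V x * rep u x * rep v x| ≤ M * ‖u‖ * ‖v‖ := by
  have hmem : MemLp (fun x => V x * rep u x) 2 volume :=
    (isH1_rep u).memLp.of_le_mul (c := M)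
      (hV.aestronglyMeasurable.mul (isH1_rep u).memLp.1)
      (Filter.Eventually.of_forall fun x => by
        rw [norm_mul]; exact mul_le_mul_of_nonneg_right (hM x) (norm_nonneg _))
  have h1 := inner_eq_integral hmem.coeFn_toLp (val_ae_eq v)
  rw [← h1]
  have h2 : ‖hmem.toLp‖ ≤ M * ‖val u‖ := by
    refine Lp.norm_le_mul_norm_of_ae_le_mul ?_
    filter_upwards [hmem.coeFn_toLp, val_ae_eq u] with x hx hu
    rw [hx, hu, norm_mul]
    exact mul_le_mul_of_nonneg_right (hM x) (norm_nonneg _)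
  have hM0 : 0 ≤ M := (abs_nonneg _).trans (hM 0)
  refine (abs_real_inner_le_norm _ _).trans ?_
  exact mul_le_mul (h2.trans (mul_le_mul_of_nonneg_left (norm_val_le u) hM0)) (norm_val_le v)
    (norm_nonneg _) (by positivity)

/-- The form as a bounded bilinear form on `H¹`. -/
def bilin (ω γ : ℝ) (V : ℝ → ℝ) {M : ℝ} (hV : Measurable V) (hM : ∀ x, |V x| ≤ M) :
    H1 →L[ℝ] H1 →L[ℝ] ℝ :=
  have hadd : ∀ u v w : H1, form ω γ V (rep (u + v)) (der (u + v)) (rep w) (der w) =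
      form ω γ V (rep u) (der u) (rep w) (der w) + form ω γ V (rep v) (der v) (rep w) (der w) := by
    intro u v w
    rw [← form_add hV ⟨M, hM⟩ (isH1_rep u) (isH1_rep v) (isH1_rep w), rep_add]
    exact form_congr (Lp.coeFn_add (der u) (der v)) Filter.EventuallyEq.rfl
  have hsmul : ∀ (a : ℝ) (u w : H1), form ω γ V (rep (a • u)) (der (a • u)) (rep w) (der w) =
      a • form ω γ V (rep u) (der u) (rep w) (der w) := by
    intro a u w
    rw [smul_eq_mul, ← form_smul, rep_smul]
    exact form_congr (Lp.coeFn_smul a (der u)) Filter.EventuallyEq.rfl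
  LinearMap.mkContinuous₂
    (LinearMap.mk₂ ℝ (fun u v => form ω γ V (rep u) (der u) (rep v) (der v)) hadd hsmul
      (fun u v w => by
        rw [form_symm, hadd, form_symm, form_symm _ _ _ (rep w)])
      (fun a u v => by rw [form_symm, hsmul, form_symm]))
    (1 + |ω| + |γ| * (‖eval₀‖ * ‖eval₀‖) + M) (fun u v => by
      simp only [LinearMap.mk₂_apply, form]
      have h1 : |∫ x, der u x * der v x| ≤ ‖u‖ * ‖v‖ := by
        rw [← inner_eq_integral Filter.EventuallyEq.rfl Filter.EventuallyEq.rfl]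
        exact (abs_real_inner_le_norm _ _).trans
          (mul_le_mul (norm_der_le u) (norm_der_le v) (norm_nonneg _) (norm_nonneg _))
      have h2 : |∫ x, rep u x * rep v x| ≤ ‖u‖ * ‖v‖ := by
        rw [← inner_eq_integral (val_ae_eq u) (val_ae_eq v)]
        exact (abs_real_inner_le_norm _ _).trans
          (mul_le_mul (norm_val_le u) (norm_val_le v) (norm_nonneg _) (norm_nonneg _))
      have h3 : |rep u 0 * rep v 0| ≤ (‖eval₀‖ * ‖eval₀‖) * (‖u‖ * ‖v‖) := by
        rw [abs_mul]
        calc _ ≤ (‖eval₀‖ * ‖u‖) * (‖eval₀‖ * ‖v‖) :=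
              mul_le_mul (eval₀.le_opNorm u) (eval₀.le_opNorm v) (abs_nonneg _) (by positivity)
          _ = _ := by ring
      have h4 := abs_integral_potential_le hV hM u v
      rw [Real.norm_eq_abs]
      calc _ ≤ |∫ x, der u x * der v x| + |ω| * |∫ x, rep u x * rep v x| +
            |γ| * |rep u 0 * rep v 0| + |∫ x, V x * rep u x * rep v x| := by
            rw [← abs_mul, ← abs_mul]
            exact (abs_sub _ _).trans (add_le_add_left ((abs_sub _ _).trans
              (add_le_add_left (abs_add_le _ _) _)) _)
        _ ≤ ‖u‖ * ‖v‖ + |ω| * (‖u‖ * ‖v‖) + |γ| * ((‖eval₀‖ * ‖eval₀‖) * (‖u‖ * ‖v‖)) +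
            M * ‖u‖ * ‖v‖ := by gcongr
        _ = _ := by ring)

theorem bilin_apply {ω γ : ℝ} {V : ℝ → ℝ} {M : ℝ} (hV : Measurable V) (hM : ∀ x, |V x| ≤ M)
    (u v : H1) : bilin ω γ V hV hM u v = form ω γ V (rep u) (der u) (rep v) (der v) := rfl

end H1

/-- Solvability of `L v - s v = w` for very negative `s`, by the Lax-Milgram theorem. -/
theorem exists_represents_sub {ω γ M s : ℝ} {V : ℝ → ℝ} (hV : Measurable V)
    (hM : ∀ x, |V x| ≤ M) (hs : M + 8 * (|γ| + 1) ^ 2 + 1 ≤ ω - s) (w : L2R) :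
    ∃ v : L2R, Represents ω γ V v (w + s • v) := by
  have hco : IsCoercive (H1.bilin (ω - s) γ V hV hM) := by
    refine ⟨1 / 2, by norm_num, fun u => ?_⟩
    have h := form_coercive hV hM hs (H1.isH1_rep u)
    rw [H1.bilin_apply, mul_assoc, ← pow_two, H1.norm_sq, norm_sq_eq_integral (H1.val_ae_eq u),
      norm_sq_eq_integral (u := H1.der u) Filter.EventuallyEq.rfl]
    have : 0 ≤ ∫ x, H1.rep u x * H1.rep u x := integral_nonneg fun x => mul_self_nonneg _
    linarith
  -- The right-hand side $z\mapsto\langle w,z\rangle$ as a functional on $H^1$: Riesz represents it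
  -- by `y`, and Lax-Milgram turns `y` into the solution.
  let φ : H1 →L[ℝ] ℝ := (innerSL ℝ w).comp ((WithLp.fstL 2 ℝ L2R L2R).comp H1.subtypeL)
  have hφ : ∀ u : H1, φ u = ⟪w, H1.val u⟫_ℝ := fun u => rfl
  set y := (InnerProductSpace.toDual ℝ H1).symm φ with hy
  set u := hco.continuousLinearEquivOfBilin.symm y with hu
  refine ⟨H1.val u, H1.rep u, H1.der u, H1.isH1_rep u, H1.val_ae_eq u, fun z z' hz => ?_⟩
  have h1 : form (ω - s) γ V (H1.rep u) (H1.der u) z z' = ∫ x, w x * z x := by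
    have h2 := hco.continuousLinearEquivOfBilin_apply u (H1.mk hz)
    rw [hu, ContinuousLinearEquiv.apply_symm_apply, ← hu, hy, InnerProductSpace.toDual_symm_apply,
      hφ, inner_eq_integral Filter.EventuallyEq.rfl (H1.val_mk hz), H1.bilin_apply, H1.rep_mk] at h2
    rw [h2]
    exact form_congr Filter.EventuallyEq.rfl (H1.der_mk hz).symm
  rw [form_shift] at h1
  have hint : Integrable fun x => s * (H1.rep u x * z x) :=
    ((H1.isH1_rep u).memLp.integrable_mul hz.memLp).const_mul s
  have h3 : ∫ x, (w + s • H1.val u) x * z x =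
      (∫ x, w x * z x) + s * ∫ x, H1.rep u x * z x := by
    rw [← integral_const_mul, ← integral_add (integrable_pair w hz.memLp) hint]
    refine integral_congr_ae ?_
    filter_upwards [Lp.coeFn_add w (s • H1.val u), Lp.coeFn_smul s (H1.val u),
      H1.val_ae_eq u] with x e1 e2 e3
    rw [e1, Pi.add_apply, e2, Pi.smul_apply, e3, smul_eq_mul]
    ring
  rw [h3]
  linarith

end SobolevSpace

/-! ### Lower bound of the form on functions vanishing on a finite grid -/

section FiniteCodimension

/-- A crude Poincaré inequality needing a zero at one endpoint only: bound $f(t)^2$ by $(b-a)\int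
f'^2$ and integrate. -/
theorem IsH1.intervalIntegral_mul_self_le_of_eq_zero {f f' : ℝ → ℝ} (hf : IsH1 f f') {a b : ℝ}
    (hab : a ≤ b) (ha : f a = 0) :
    ∫ t in a..b, f t * f t ≤ (b - a) ^ 2 * ∫ t in a..b, f' t * f' t := by
  have hD : IntervalIntegrable (fun t => f' t * f' t) volume a b :=
    (integrable_mul_self hf.memLp_deriv).intervalIntegrable
  have hpt : ∀ t ∈ Set.Icc a b, f t * f t ≤ (b - a) * ∫ s in a..b, f' s * f' s := by
    intro t ht
    have h1 := hf.sq_sub_le ht.1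
    rw [ha, sub_zero, pow_two] at h1
    refine h1.trans (mul_le_mul (by linarith [ht.2]) ?_ ?_ (by linarith))
    · exact intervalIntegral.integral_mono_interval le_rfl ht.1 ht.2
        (Filter.Eventually.of_forall fun x => mul_self_nonneg _) hD
    · exact intervalIntegral.integral_nonneg ht.1 fun t _ => mul_self_nonneg _
  have h := intervalIntegral.integral_mono_on hab
    (integrable_mul_self hf.memLp).intervalIntegrable (by simp) hpt
  rw [intervalIntegral.integral_const, smul_eq_mul] at h
  linarith

/-- If the potential is small at infinity, the form is bounded below by `ω / 2` on the `H¹`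
functions which vanish at suitable finitely many points. -/
theorem exists_finset_form_ge {ω γ M R : ℝ} (hω : 0 < ω) {V : ℝ → ℝ} (hV : Measurable V)
    (hM : ∀ x, |V x| ≤ M) (hR : ∀ x, R ≤ |x| → V x ≤ ω / 2) :
    ∃ T : Finset ℝ, ∀ f f' : ℝ → ℝ, IsH1 f f' → (∀ x ∈ T, f x = 0) →
      ω / 2 * ∫ x, f x * f x ≤ form ω γ V f f' f f' := by
  have hM0 : 0 ≤ M := (abs_nonneg _).trans (hM 0)
  -- The mesh satisfies $Mh^2\le1$, so on the grid the derivative term absorbs $M\int f^2$; the $1$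
  -- avoids division by zero.
  set h := 1 / (M + 1) with hh
  have hpos : 0 < h := by positivity
  have hle : h ≤ 1 := by rw [hh, div_le_one (by linarith)]; linarith
  have hMh : M * h ^ 2 ≤ 1 := by
    have h1 : M * h ≤ 1 := by
      rw [hh, mul_one_div, div_le_one (by linarith)]; linarith
    nlinarith
  set N := ⌈R / h⌉₊ with hN
  have hRN : R ≤ N * h := by
    rw [← div_le_iff₀ hpos]; exact Nat.le_ceil _
  -- Points from $-Nh$ to $Nh$, with $Nh\ge R$. The index $N$ gives the origin, which removes the
  -- delta term.
  let a : ℕ → ℝ := fun i => -(N * h) + i * h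
  refine ⟨(Finset.range (2 * N + 1)).image a, fun f f' hf hT => ?_⟩
  have ha : ∀ i ∈ Finset.range (2 * N + 1), f (a i) = 0 := fun i hi =>
    hT _ (Finset.mem_image_of_mem a hi)
  have h0 : f 0 = 0 := by
    have := ha N (Finset.mem_range.2 (by omega))
    simpa [a] using this
  have haN : a (2 * N) = N * h := by simp only [a]; push_cast; ring
  have ha0 : a 0 = -(N * h) := by simp [a]
  have hstep : ∀ i, a (i + 1) - a i = h := fun i => by simp only [a]; push_cast; ring
  have hloc : ∫ t in -(N * h)..(N * h), f t * f t ≤ h ^ 2 * ∫ t, f' t * f' t := by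
    rw [← ha0, ← haN, ← intervalIntegral.sum_integral_adjacent_intervals
      (fun k _ => (integrable_mul_self hf.memLp).intervalIntegrable)]
    have h1 : ∀ k ∈ Finset.range (2 * N), ∫ t in a k..a (k + 1), f t * f t ≤
        h ^ 2 * ∫ t in a k..a (k + 1), f' t * f' t := by
      intro k hk
      rw [← hstep k]
      exact hf.intervalIntegral_mul_self_le_of_eq_zero (by linarith [hstep k])
        (ha k (Finset.mem_range.2 (by have := Finset.mem_range.1 hk; omega)))
    refine (Finset.sum_le_sum h1).trans ?_
    rw [← Finset.mul_sum, intervalIntegral.sum_integral_adjacent_intervals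
      (fun k _ => (integrable_mul_self hf.memLp_deriv).intervalIntegrable)]
    refine mul_le_mul_of_nonneg_left (intervalIntegral_mul_self_le hf.memLp_deriv ?_)
      (by positivity)
    rw [ha0, haN]
    have : 0 ≤ N * h := by positivity
    linarith
  -- Pointwise, $V\le M$ inside the grid and $V\le\omega/2$ outside it.
  have hpot : ∫ x, V x * f x * f x ≤ ω / 2 * (∫ x, f x * f x) +
      M * ∫ t in -(N * h)..(N * h), f t * f t := by
    have hNh : -(N * h) ≤ N * h := by
      have : 0 ≤ N * h := by positivity
      linarith
    rw [intervalIntegral.integral_of_le hNh, ← integral_const_mul, ← integral_const_mul,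
      ← integral_indicator measurableSet_Ioc]
    have i1 : Integrable fun x => ω / 2 * (f x * f x) := (integrable_mul_self hf.memLp).const_mul _
    have i2 : Integrable ((Set.Ioc (-(N * h)) (N * h)).indicator fun x => M * (f x * f x)) :=
      ((integrable_mul_self hf.memLp).const_mul _).indicator measurableSet_Ioc
    rw [← integral_add i1 i2]
    refine integral_mono (integrable_potential hV ⟨M, hM⟩ hf.memLp hf.memLp) (i1.add i2)
      fun x => ?_
    have hfx := mul_self_nonneg (f x)
    simp only [mul_assoc (V x)]
    by_cases hx : x ∈ Set.Ioc (-(N * h)) (N * h)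
    · rw [Set.indicator_of_mem hx]
      nlinarith [le_abs_self (V x), hM x]
    · rw [Set.indicator_of_notMem hx, add_zero]
      refine mul_le_mul_of_nonneg_right (hR x (hRN.trans ?_)) hfx
      by_contra hlt
      rw [not_le, abs_lt] at hlt
      exact hx ⟨hlt.1, hlt.2.le⟩
  have hD : 0 ≤ ∫ x, f' x * f' x := integral_nonneg fun x => mul_self_nonneg _
  simp only [form, h0]
  have h3 : M * ∫ t in -(N * h)..(N * h), f t * f t ≤ ∫ x, f' x * f' x := by
    refine (mul_le_mul_of_nonneg_left hloc hM0).trans ?_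
    rw [← mul_assoc]
    exact mul_le_of_le_one_left hD hMh
  linarith

end FiniteCodimension

/-! ### Integration by parts for absolutely continuous functions; reflection -/

section IntegrationByParts

/-- `f` is a primitive of the locally integrable function `f'`. -/
structure IsPrimitive (f f' : ℝ → ℝ) : Prop where
  locallyIntegrable : LocallyIntegrable f' volume
  eq_integral : ∀ x, f x = f 0 + ∫ t in (0 : ℝ)..x, f' t

theorem IsH1.isPrimitive {f f' : ℝ → ℝ} (hf : IsH1 f f') : IsPrimitive f f' :=
  ⟨hf.memLp_deriv.locallyIntegrable (by norm_num), hf.eq_integral⟩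

theorem isPrimitive_of_hasDerivAt {f f' : ℝ → ℝ} (hf : ∀ x, HasDerivAt f (f' x) x)
    (hf' : Continuous f') : IsPrimitive f f' :=
  ⟨hf'.locallyIntegrable, fun x => by
    rw [intervalIntegral.integral_eq_sub_of_hasDerivAt (fun y _ => hf y)
      (hf'.intervalIntegrable _ _)]
    ring⟩

namespace IsPrimitive

variable {f f' g g' : ℝ → ℝ}

theorem intervalIntegrable (hf : IsPrimitive f f') (a b : ℝ) :
    IntervalIntegrable f' volume a b :=
  (hf.locallyIntegrable.integrableOn_isCompact isCompact_uIcc).intervalIntegrable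

theorem eq_add_integral (hf : IsPrimitive f f') (a x : ℝ) :
    f x = f a + ∫ t in a..x, f' t := by
  rw [hf.eq_integral x, hf.eq_integral a, add_assoc,
    intervalIntegral.integral_add_adjacent_intervals] <;>
  exact hf.intervalIntegrable _ _

theorem ae_hasDerivAt (hf : IsPrimitive f f') : ∀ᵐ x, HasDerivAt f (f' x) x := by
  filter_upwards [_root_.LocallyIntegrable.ae_hasDerivAt_integral hf.locallyIntegrable] with x hx
  rw [show f = fun x => f 0 + ∫ t in (0 : ℝ)..x, f' t from funext hf.eq_integral]
  exact (hx 0).const_add _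

theorem absolutelyContinuousOnInterval (hf : IsPrimitive f f') (a b : ℝ) :
    AbsolutelyContinuousOnInterval f a b := by
  rw [show f = fun x => f a + ∫ t in a..x, f' t from funext (hf.eq_add_integral a)]
  refine AbsolutelyContinuousOnInterval.fun_add ?_
    ((hf.intervalIntegrable a b).absolutelyContinuousOnInterval_intervalIntegral
      Set.left_mem_uIcc)
  exact ((LipschitzWith.const (f a)).lipschitzOnWith (s := Set.uIcc a b)).absolutelyContinuousOnInterval

theorem integral_mul (hf : IsPrimitive f f') (hg : IsPrimitive g g') (a b : ℝ) :
    ∫ x in a..b, (f' x * g x + f x * g' x) = f b * g b - f a * g a := by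
  rw [← (hf.absolutelyContinuousOnInterval a b).integral_deriv_mul_eq_sub
    (hg.absolutelyContinuousOnInterval a b)]
  refine intervalIntegral.integral_congr_ae ?_
  filter_upwards [hf.ae_hasDerivAt, hg.ae_hasDerivAt] with x h1 h2 _
  rw [h1.deriv, h2.deriv]

/-- No decay of $fg$ has to be assumed: integrability of $(fg)'$ makes $fg$ converge at infinity,
and integrability of $fg$ forces the limit to be $0$. -/
theorem integral_Ioi_mul (hf : IsPrimitive f f') (hg : IsPrimitive g g')
    (h0 : IntegrableOn (fun x => f x * g x) (Set.Ioi 0))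
    (h1 : IntegrableOn (fun x => f' x * g x + f x * g' x) (Set.Ioi 0)) :
    ∫ x in Set.Ioi 0, (f' x * g x + f x * g' x) = -(f 0 * g 0) := by
  have hlim := intervalIntegral_tendsto_integral_Ioi 0 h1 Filter.tendsto_id
  simp only [id, hf.integral_mul hg] at hlim
  have hlim2 := hlim.add_const (f 0 * g 0)
  simp only [sub_add_cancel] at hlim2
  have hint : IntegrableAtFilter (fun x => f x * g x) Filter.atTop volume :=
    ⟨Set.Ioi 0, Filter.Ioi_mem_atTop 0, h0⟩
  have hz := hint.eq_zero_of_tendsto (fun s hs => by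
    obtain ⟨a, ha⟩ := Filter.mem_atTop_sets.1 hs
    exact top_unique ((Real.volume_Ici (a := a)).symm.le.trans (measure_mono ha))) hlim2
  linarith

end IsPrimitive

theorem IsH1.comp_neg {f f' : ℝ → ℝ} (hf : IsH1 f f') :
    IsH1 (fun x => f (-x)) (fun x => -f' (-x)) := by
  refine ⟨hf.memLp.comp_measurePreserving (Measure.measurePreserving_neg volume),
    (hf.memLp_deriv.comp_measurePreserving (Measure.measurePreserving_neg volume)).neg,
    fun x => ?_⟩
  rw [intervalIntegral.integral_neg, intervalIntegral.integral_comp_neg, neg_zero,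
    intervalIntegral.integral_symm, neg_neg]
  exact hf.eq_integral (-x)

/-- For an even potential, reflection is a symmetry of the form; it carries results on the positive
half-line to the negative one. -/
theorem form_comp_neg {ω γ : ℝ} {V : ℝ → ℝ} (hV : ∀ x, V (-x) = V x) (f f' z z' : ℝ → ℝ) :
    form ω γ V (fun x => f (-x)) (fun x => -f' (-x)) z z' =
      form ω γ V f f' (fun x => z (-x)) (fun x => -z' (-x)) := by
  simp only [form]
  rw [← integral_neg_eq_self (fun x => -f' (-x) * z' x), ← integral_neg_eq_self
    (fun x => f (-x) * z x), ← integral_neg_eq_self (fun x => V x * f (-x) * z x)]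
  simp only [neg_neg, hV, neg_zero, neg_mul_comm]

end IntegrationByParts

/-! ### Decaying solutions on the half-line, Wronskian and uniqueness -/

section HalfLine

theorem integral_eq_integral_Ioi_add {F : ℝ → ℝ} (hF : Integrable F) :
    ∫ x, F x = ∫ x in Set.Ioi 0, (F x + F (-x)) := by
  have h1 : ∫ x in Set.Ioi 0, F (-x) = ∫ x in Set.Iic 0, F x := by
    rw [integral_comp_neg_Ioi, neg_zero]
  rw [integral_add hF.integrableOn hF.comp_neg.integrableOn, h1, ← Set.compl_Ioi, integral_add_compl
    measurableSet_Ioi hF]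

theorem memLp_two_comp_abs {F : ℝ → ℝ} (hc : Continuous F)
    (hF : MemLp F 2 (volume.restrict (Set.Ioi 0))) : MemLp (fun x => F |x|) 2 volume := by
  have hm : AEStronglyMeasurable (fun x => F |x|) volume :=
    (hc.comp continuous_abs).aestronglyMeasurable
  rw [memLp_two_iff_integrable_sq hm]
  have h1 : Integrable ((Set.Ioi (0 : ℝ)).indicator fun x => F x ^ 2) :=
    (integrable_indicator_iff measurableSet_Ioi).2
      ((memLp_two_iff_integrable_sq hc.aestronglyMeasurable).1 hF)
  refine (h1.add h1.comp_neg).congr ?_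
  filter_upwards [compl_mem_ae_iff.2 (measure_singleton (0 : ℝ))] with x hx
  rw [Pi.add_apply]
  rcases lt_or_gt_of_ne (show x ≠ 0 from hx) with hneg | hpos
  · rw [Set.indicator_of_notMem (by simpa using hneg.le), Set.indicator_of_mem (by simpa using hneg),
      abs_of_neg hneg, zero_add]
  · rw [Set.indicator_of_mem (by simpa using hpos), Set.indicator_of_notMem (by simpa using hpos.le),
      abs_of_pos hpos, add_zero]

/-- `Ψ` solves `Ψ'' = (ω - U) Ψ` and is, with its derivative `Ψ₁`, square integrable on the
positive half-line. -/
structure IsDecayingSolution (ω : ℝ) (U Ψ Ψ₁ : ℝ → ℝ) : Prop where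
  hasDerivAt : ∀ x, HasDerivAt Ψ (Ψ₁ x) x
  hasDerivAt_deriv : ∀ x, HasDerivAt Ψ₁ ((ω - U x) * Ψ x) x
  memLp : MemLp Ψ 2 (volume.restrict (Set.Ioi 0))
  memLp_deriv : MemLp Ψ₁ 2 (volume.restrict (Set.Ioi 0))

/-- The derivative of the even function `x ↦ Ψ |x|` off the origin, where `Ψ₁ = Ψ'`. -/
def evenDeriv (Ψ₁ : ℝ → ℝ) (x : ℝ) : ℝ := if 0 ≤ x then Ψ₁ x else -Ψ₁ (-x)

namespace IsDecayingSolution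

variable {ω γ : ℝ} {U Ψ Ψ₁ : ℝ → ℝ}

theorem continuous (h : IsDecayingSolution ω U Ψ Ψ₁) : Continuous Ψ :=
  continuous_iff_continuousAt.2 fun x => (h.hasDerivAt x).continuousAt

theorem continuous_deriv (h : IsDecayingSolution ω U Ψ Ψ₁) : Continuous Ψ₁ :=
  continuous_iff_continuousAt.2 fun x => (h.hasDerivAt_deriv x).continuousAt

/-- The kink at the origin is harmless: the even extension is continuous there, and the fundamental
theorem of calculus tolerates one exceptional point. -/
theorem isH1_comp_abs (h : IsDecayingSolution ω U Ψ Ψ₁) :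
    IsH1 (fun x => Ψ |x|) (evenDeriv Ψ₁) := by
  have hmem : MemLp (evenDeriv Ψ₁) 2 volume := by
    refine (memLp_two_comp_abs h.continuous_deriv h.memLp_deriv).mono ?_ ?_
    · exact (Measurable.ite measurableSet_Ici h.continuous_deriv.measurable
        (h.continuous_deriv.comp continuous_neg).neg.measurable).aestronglyMeasurable
    · refine Filter.Eventually.of_forall fun x => ?_
      unfold evenDeriv
      split_ifs with hx
      · rw [abs_of_nonneg hx]
      · rw [abs_of_neg (not_le.1 hx), norm_neg]
  refine ⟨memLp_two_comp_abs h.continuous h.memLp, hmem, fun x => ?_⟩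
  rw [integral_eq_of_hasDerivAt_off_countable (fun x => Ψ |x|) (evenDeriv Ψ₁)
    (Set.countable_singleton 0) (h.continuous.comp continuous_abs).continuousOn ?_
    (intervalIntegrable_of_memLp hmem 0 x)]
  · ring
  · rintro y ⟨-, hy⟩
    rcases lt_or_gt_of_ne (show y ≠ 0 from hy) with hneg | hpos
    · have e : (fun x => Ψ |x|) =ᶠ[nhds y] fun x => Ψ (-x) := by
        filter_upwards [gt_mem_nhds hneg] with t ht
        rw [abs_of_neg ht]
      have h1 := (h.hasDerivAt (-y)).comp y (hasDerivAt_neg y)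
      rw [evenDeriv, if_neg (not_le.2 hneg)]
      refine HasDerivAt.congr_of_eventuallyEq ?_ e
      simpa [Function.comp_def] using h1
    · have e : (fun x => Ψ |x|) =ᶠ[nhds y] Ψ := by
        filter_upwards [lt_mem_nhds hpos] with t ht
        rw [abs_of_pos ht]
      rw [evenDeriv, if_pos hpos.le]
      exact (h.hasDerivAt y).congr_of_eventuallyEq e

/-- The form of the even extension of a solution on the half-line is a multiple of the point
evaluation at the origin. -/
theorem form_comp_abs (h : IsDecayingSolution ω U Ψ Ψ₁) (hU : Continuous U) {M : ℝ}
    (hM : ∀ x, |U (|x|)| ≤ M) {z z' : ℝ → ℝ} (hz : IsH1 z z') :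
    form ω γ (fun x => U |x|) (fun x => Ψ |x|) (evenDeriv Ψ₁) z z' =
      -(2 * Ψ₁ 0 + γ * Ψ 0) * z 0 := by
  have hψ := h.isH1_comp_abs
  have i1 : Integrable fun x => evenDeriv Ψ₁ x * z' x :=
    hψ.memLp_deriv.integrable_mul hz.memLp_deriv
  have i2 : Integrable fun x => ω * (Ψ |x| * z x) := (hψ.memLp.integrable_mul hz.memLp).const_mul ω
  have i3 : Integrable fun x => U |x| * Ψ |x| * z x :=
    integrable_potential (hU.comp continuous_abs).measurable ⟨M, hM⟩ hψ.memLp hz.memLp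
  -- Folding the line at the origin replaces `z` by $y(x)=z(x)+z(-x)$ on the half-line. By the
  -- equation for $\Psi$ the folded integrand is $(\Psi_1y)'$, so only
  -- $-\Psi_1(0)y(0)=-2\Psi_1(0)z(0)$ remains.
  set y : ℝ → ℝ := z + fun x => z (-x) with hy
  set y' : ℝ → ℝ := z' + fun x => -z' (-x) with hy'
  have hyH : IsH1 y y' := hz.add hz.comp_neg
  have i12 : Integrable fun x => evenDeriv Ψ₁ x * z' x + ω * (Ψ |x| * z x) := i1.add i2
  have i123 : Integrable fun x => evenDeriv Ψ₁ x * z' x + ω * (Ψ |x| * z x) -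
    U |x| * Ψ |x| * z x := i12.sub i3
  have hform : form ω γ (fun x => U |x|) (fun x => Ψ |x|) (evenDeriv Ψ₁) z z' =
      (∫ x, (evenDeriv Ψ₁ x * z' x + ω * (Ψ |x| * z x) - U |x| * Ψ |x| * z x)) -
        γ * (Ψ 0 * z 0) := by
    rw [integral_sub i12 i3, integral_add i1 i2, integral_const_mul]
    simp only [form, abs_zero]
    ring
  have heq : ∀ x ∈ Set.Ioi (0 : ℝ),
      (evenDeriv Ψ₁ x * z' x + ω * (Ψ |x| * z x) - U |x| * Ψ |x| * z x) +
      (evenDeriv Ψ₁ (-x) * z' (-x) + ω * (Ψ |(-x)| * z (-x)) - U |(-x)| * Ψ |(-x)| * z (-x)) =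
      (ω - U x) * Ψ x * y x + Ψ₁ x * y' x := by
    intro x hx
    have hx0 : (0 : ℝ) < x := hx
    simp only [evenDeriv, if_pos hx0.le, if_neg (not_le.2 (neg_lt_zero.2 hx0)), abs_neg, neg_neg,
      abs_of_pos hx0, hy, hy', Pi.add_apply]
    ring
  have j0 : IntegrableOn (fun x => Ψ₁ x * y x) (Set.Ioi 0) :=
    h.memLp_deriv.integrable_mul (hyH.memLp.restrict _)
  have hparts := (isPrimitive_of_hasDerivAt h.hasDerivAt_deriv
    ((continuous_const.sub hU).mul h.continuous)).integral_Ioi_mul hyH.isPrimitive j0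
      ((integrableOn_congr_fun heq measurableSet_Ioi).1
        (i123.integrableOn.add i123.comp_neg.integrableOn))
  have hy0 : y 0 = 2 * z 0 := by simp only [hy, Pi.add_apply, neg_zero]; ring
  rw [hform, integral_eq_integral_Ioi_add i123, setIntegral_congr_fun measurableSet_Ioi heq, hparts,
    hy0]
  ring

end IsDecayingSolution

/-- A function in the kernel of the form which vanishes at the origin solves the differential
equation on the positive half-line. -/
theorem exists_eq_integral_of_form_eq_zero {ω γ : ℝ} {V : ℝ → ℝ} (hV : Continuous V)
    {M : ℝ} (hM : ∀ x, |V x| ≤ M) {g g' : ℝ → ℝ} (hg : IsH1 g g') (h0 : g 0 = 0)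
    (hker : ∀ z z' : ℝ → ℝ, IsH1 z z' → form ω γ V g g' z z' = 0) :
    ∃ c : ℝ, ∀ x, 0 ≤ x → g x = ∫ t in (0 : ℝ)..x, (c - ∫ s in (0 : ℝ)..t, (V s - ω) * g s) := by
  set k : ℝ → ℝ := fun s => (V s - ω) * g s with hk
  have hkc : Continuous k := (hV.sub continuous_const).mul hg.continuous
  set K : ℝ → ℝ := fun t => ∫ s in (0 : ℝ)..t, k s with hK
  have hKd : ∀ t, HasDerivAt K (k t) t := fun t => (hkc.integral_hasStrictDerivAt 0 t).hasDerivAt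
  have hKc : Continuous K := continuous_iff_continuousAt.2 fun x => (hKd x).continuousAt
  have hKp : IsPrimitive K k := isPrimitive_of_hasDerivAt hKd hkc
  have hK0 : K 0 = 0 := by simp [hK]
  -- Du Bois-Reymond argument: the weak equation should make $g'+K$ constant on $(0,b]$.
  have local_eq : ∀ b : ℝ, 0 < b → ∃ c : ℝ, ∀ x ∈ Set.Icc 0 b,
      g x = ∫ t in (0 : ℝ)..x, (c - K t) := by
    intro b hb
    have hqi : IntervalIntegrable (fun t => g' t + K t) volume 0 b :=
      (intervalIntegrable_of_memLp hg.memLp_deriv 0 b).add (hKc.intervalIntegrable 0 b)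
    -- The mean of $g'+K$, chosen so that the test function `z` below returns to $0$ at $b$ and has
    -- compact support.
    set c := (∫ t in (0 : ℝ)..b, (g' t + K t)) / b with hc
    set z' : ℝ → ℝ := (Set.Ioc 0 b).indicator fun t => g' t + K t - c with hz'
    have hz'mem : MemLp z' 2 volume := by
      have e : z' = (Set.Ioc 0 b).indicator g' + (Set.Ioc 0 b).indicator fun t => K t - c := by
        funext t
        simp only [hz', Pi.add_apply, Set.indicator_apply]
        split_ifs <;> ring
      rw [e]
      refine (hg.memLp_deriv.indicator measurableSet_Ioc).add ?_
      rw [memLp_indicator_iff_restrict measurableSet_Ioc]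
      have hcont : Continuous fun t => K t - c := hKc.sub continuous_const
      obtain ⟨C, hC⟩ := isCompact_Icc.exists_bound_of_continuousOn
        (hcont.continuousOn (s := Set.Icc 0 b))
      refine MemLp.of_bound hcont.aestronglyMeasurable C ?_
      filter_upwards [ae_restrict_mem measurableSet_Ioc] with t ht
      exact hC t ⟨ht.1.le, ht.2⟩
    have hz'i : ∀ u v : ℝ, IntervalIntegrable z' volume u v := intervalIntegrable_of_memLp hz'mem
    have hzsub : ∀ x ∈ Set.Icc 0 b, ∫ t in (0 : ℝ)..x, z' t =
        ∫ t in (0 : ℝ)..x, (g' t + K t - c) := by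
      intro x hx
      refine intervalIntegral.integral_congr_ae (Filter.Eventually.of_forall fun t ht => ?_)
      rw [Set.uIoc_of_le hx.1] at ht
      exact Set.indicator_of_mem (show t ∈ Set.Ioc 0 b from ⟨ht.1, ht.2.trans hx.2⟩) _
    set z : ℝ → ℝ := fun x => ∫ t in (0 : ℝ)..x, z' t with hz
    have hzb : z b = 0 := by
      rw [hz]
      simp only
      rw [hzsub b (Set.right_mem_Icc.2 hb.le), intervalIntegral.integral_sub hqi (by simp),
        intervalIntegral.integral_const, smul_eq_mul, sub_zero, hc]
      field_simp
      ring
    have hzneg : ∀ x, x ≤ 0 → z x = 0 := by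
      intro x hx
      simp only [hz]
      rw [intervalIntegral.integral_symm, intervalIntegral.integral_of_le hx,
        setIntegral_eq_zero_of_forall_eq_zero, neg_zero]
      intro t ht
      exact Set.indicator_of_notMem (fun h => absurd h.1 (not_lt.2 ht.2)) _
    have hzpos : ∀ x, b ≤ x → z x = 0 := by
      intro x hx
      have h1 : z x = z b + ∫ t in b..x, z' t := by
        simp only [hz]
        rw [intervalIntegral.integral_add_adjacent_intervals (hz'i _ _) (hz'i _ _)]
      rw [h1, hzb, zero_add, intervalIntegral.integral_of_le hx]
      refine setIntegral_eq_zero_of_forall_eq_zero fun t ht => ?_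
      exact Set.indicator_of_notMem (fun h => absurd h.2 (not_le.2 ht.1)) _
    have hzc : Continuous z := intervalIntegral.continuous_primitive hz'i 0
    have hzcs : HasCompactSupport z :=
      HasCompactSupport.intro (isCompact_Icc (a := 0) (b := b)) fun x hx => by
        by_cases h : x ≤ 0
        · exact hzneg x h
        · exact hzpos x (by
            by_contra h2
            exact hx ⟨(not_le.1 h).le, (not_le.1 h2).le⟩)
    have hzH : IsH1 z z' := ⟨hzc.memLp_of_hasCompactSupport hzcs, hz'mem, fun x => by simp [hz]⟩
    have hB := hker z z' hzH
    have hsplit : ∫ x, g' x * z' x = ∫ x, k x * z x := by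
      simp only [form, h0] at hB
      have e : ∫ x, k x * z x = (∫ x, V x * g x * z x) - ω * ∫ x, g x * z x := by
        rw [← integral_const_mul, ← integral_sub
          (integrable_potential hV.measurable ⟨M, hM⟩ hg.memLp hzH.memLp)
          ((show Integrable fun x => g x * z x from
            hg.memLp.integrable_mul hzH.memLp).const_mul ω)]
        refine integral_congr_ae (Filter.Eventually.of_forall fun x => ?_)
        simp only [hk]
        ring
      linarith
    have hlhs : ∫ x, g' x * z' x = ∫ x in (0 : ℝ)..b, g' x * z' x := by
      rw [intervalIntegral.integral_of_le hb.le, ← integral_indicator measurableSet_Ioc]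
      refine integral_congr_ae (Filter.Eventually.of_forall fun x => ?_)
      simp only
      by_cases hx : x ∈ Set.Ioc 0 b
      · rw [Set.indicator_of_mem hx]
      · rw [Set.indicator_of_notMem hx, hz', Set.indicator_of_notMem hx, mul_zero]
    have hrhs : ∫ x, k x * z x = ∫ x in (0 : ℝ)..b, k x * z x := by
      rw [intervalIntegral.integral_of_le hb.le, ← integral_indicator measurableSet_Ioc]
      refine integral_congr_ae (Filter.Eventually.of_forall fun x => ?_)
      simp only
      by_cases hx : x ∈ Set.Ioc 0 b
      · rw [Set.indicator_of_mem hx]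
      · rw [Set.indicator_of_notMem hx]
        by_cases h : x ≤ 0
        · rw [hzneg x h, mul_zero]
        · rw [hzpos x (by
            by_contra h2
            exact hx ⟨not_le.1 h, (not_le.1 h2).le⟩), mul_zero]
    have hparts := hKp.integral_mul hzH.isPrimitive 0 b
    have ikz : IntervalIntegrable (fun x => k x * z x) volume 0 b :=
      (hkc.mul hzc).intervalIntegrable 0 b
    have iKz : IntervalIntegrable (fun x => K x * z' x) volume 0 b :=
      (hz'i 0 b).continuousOn_mul hKc.continuousOn
    have igz : IntervalIntegrable (fun x => g' x * z' x) volume 0 b :=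
      (hg.memLp_deriv.integrable_mul hz'mem).intervalIntegrable
    rw [hzb, hK0, zero_mul, mul_zero, sub_zero, intervalIntegral.integral_add ikz iKz] at hparts
    have hq : ∫ x in (0 : ℝ)..b, (g' x * z' x + K x * z' x - c * z' x) = 0 := by
      rw [intervalIntegral.integral_sub (igz.add iKz) ((hz'i 0 b).const_mul c),
        intervalIntegral.integral_add igz iKz, intervalIntegral.integral_const_mul,
        show ∫ x in (0 : ℝ)..b, z' x = 0 from hzb]
      linarith
    -- On $(0,b]$ one has $z'=g'+K-c$, so the tested equation reads $\int z'^2=0$.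
    have hsq : ∫ x in (0 : ℝ)..b, z' x * z' x = 0 := by
      refine Eq.trans ?_ hq
      refine intervalIntegral.integral_congr_ae (Filter.Eventually.of_forall fun t ht => ?_)
      rw [Set.uIoc_of_le hb.le] at ht
      have : z' t = g' t + K t - c := Set.indicator_of_mem ht _
      linear_combination z' t * this
    have hz0 : ∀ᵐ t ∂(volume.restrict (Set.Ioc 0 b)), z' t = 0 := by
      have := (intervalIntegral.integral_eq_zero_iff_of_le_of_nonneg_ae hb.le
        (Filter.Eventually.of_forall fun t => mul_self_nonneg (z' t))
        (integrable_mul_self hz'mem).intervalIntegrable).1 hsq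
      filter_upwards [this] with t ht
      exact mul_self_eq_zero.1 ht
    rw [ae_restrict_iff' measurableSet_Ioc] at hz0
    refine ⟨c, fun x hx => ?_⟩
    rw [hg.eq_integral x, h0, zero_add]
    refine intervalIntegral.integral_congr_ae ?_
    filter_upwards [hz0] with t ht htx
    rw [Set.uIoc_of_le hx.1] at htx
    have hmem : t ∈ Set.Ioc 0 b := ⟨htx.1, htx.2.trans hx.2⟩
    have h1 := ht hmem
    rw [hz', Set.indicator_of_mem hmem] at h1
    linarith
  -- The constant does not depend on $b$: for $b\ge1$ the formulas can be compared at $x=1$.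
  obtain ⟨c, hc⟩ := local_eq 1 one_pos
  refine ⟨c, fun x hx => ?_⟩
  obtain ⟨d, hd⟩ := local_eq (max x 1) (lt_max_of_lt_right one_pos)
  have e1 := hc 1 ⟨zero_le_one, le_rfl⟩
  have e2 := hd 1 ⟨zero_le_one, le_max_right _ _⟩
  rw [intervalIntegral.integral_sub (by simp) (hKc.intervalIntegrable _ _),
    intervalIntegral.integral_const, smul_eq_mul] at e1 e2
  have hcd : c = d := by linarith
  rw [hcd]
  exact hd x ⟨hx, le_max_left _ _⟩

/-- A kernel function which vanishes at the origin vanishes on the positive half-line, if there is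
a decaying solution of the differential equation which does not vanish at the origin. -/
theorem eq_zero_of_nonneg_of_form_eq_zero {ω γ : ℝ} {V U Ψ Ψ₁ : ℝ → ℝ} (hV : Continuous V)
    {M : ℝ} (hM : ∀ x, |V x| ≤ M) (hVU : ∀ x, 0 ≤ x → V x = U x)
    (hΨ : IsDecayingSolution ω U Ψ Ψ₁) (hΨ0 : Ψ 0 ≠ 0)
    {g g' : ℝ → ℝ} (hg : IsH1 g g') (h0 : g 0 = 0)
    (hker : ∀ z z' : ℝ → ℝ, IsH1 z z' → form ω γ V g g' z z' = 0) :
    ∀ x, 0 ≤ x → g x = 0 := by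
  obtain ⟨c, hc⟩ := exists_eq_integral_of_form_eq_zero hV hM hg h0 hker
  set k : ℝ → ℝ := fun s => (V s - ω) * g s with hk
  have hkc : Continuous k := (hV.sub continuous_const).mul hg.continuous
  set g₁ : ℝ → ℝ := fun t => c - ∫ s in (0 : ℝ)..t, k s with hg₁
  have hg₁d : ∀ t, HasDerivAt g₁ (-k t) t := fun t =>
    (hkc.integral_hasStrictDerivAt 0 t).hasDerivAt.const_sub c
  have hg₁c : Continuous g₁ := continuous_iff_continuousAt.2 fun x => (hg₁d x).continuousAt
  have hGd : ∀ t, HasDerivAt (fun x => ∫ t in (0 : ℝ)..x, g₁ t) (g₁ t) t := fun t =>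
    (hg₁c.integral_hasStrictDerivAt 0 t).hasDerivAt
  -- Only right derivatives: the integral formula for `g` is known on $[0,\infty)$ alone.
  have hgd : ∀ t, 0 ≤ t → HasDerivWithinAt g (g₁ t) (Set.Ici t) t := fun t ht =>
    (hGd t).hasDerivWithinAt.congr (fun x hx => hc x (ht.trans hx)) (hc t ht)
  have hg'eq : ∀ᵐ t, t ∈ Set.Ioi (0 : ℝ) → g' t = g₁ t := by
    filter_upwards [hg.isPrimitive.ae_hasDerivAt] with t ht htpos
    exact (uniqueDiffWithinAt_Ici t).eq_deriv _ ht.hasDerivWithinAt (hgd t (le_of_lt htpos))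
  -- The Wronskian of two solutions of the same equation on $[0,\infty)$. It is constant, and
  -- integrable as a combination of products of $L^2$ functions; on a set of infinite measure it
  -- must be $0$.
  set W : ℝ → ℝ := fun t => g₁ t * Ψ t - g t * Ψ₁ t with hW
  have hWc : Continuous W :=
    (hg₁c.mul hΨ.continuous).sub (hg.continuous.mul hΨ.continuous_deriv)
  have hWconst : ∀ x, 0 ≤ x → W x = W 0 := by
    intro x hx
    refine constant_of_has_deriv_right_zero (a := 0) (b := x) hWc.continuousOn (fun t ht => ?_) x
      ⟨hx, le_rfl⟩
    have h1 := (((hg₁d t).hasDerivWithinAt (s := Set.Ici t)).mul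
      (hΨ.hasDerivAt t).hasDerivWithinAt).sub
      ((hgd t ht.1).mul (hΨ.hasDerivAt_deriv t).hasDerivWithinAt)
    refine HasDerivWithinAt.congr_deriv (f := W) h1 ?_
    simp only [hk, hVU t ht.1]
    ring
  have hWint : IntegrableOn (fun _ : ℝ => W 0) (Set.Ioi 0) := by
    have i1 : IntegrableOn (fun t => g' t * Ψ t - g t * Ψ₁ t) (Set.Ioi 0) :=
      ((hg.memLp_deriv.restrict _).integrable_mul hΨ.memLp).sub
        ((hg.memLp.restrict _).integrable_mul hΨ.memLp_deriv)
    refine i1.congr ?_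
    rw [Filter.EventuallyEq, ae_restrict_iff' measurableSet_Ioi]
    filter_upwards [hg'eq] with t ht htpos
    rw [← hWconst t (le_of_lt htpos), ht htpos]
  have hW0 : W 0 = 0 := by
    rcases (integrableOn_const_iff (by simp)).1 hWint with h | h
    · simpa using h
    · simp at h
  have hc0 : g₁ 0 = 0 := by
    simp only [hW, h0, zero_mul, sub_zero] at hW0
    exact (mul_eq_zero.1 hW0).resolve_right hΨ0
  intro b hb
  -- Gronwall for the first-order system $(g,g_1)$ with zero initial data.
  have hzero := eq_zero_of_abs_deriv_le_mul_abs_self_of_eq_zero_right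
    (f := fun t => (g t, g₁ t)) (f' := fun t => (g₁ t, -k t)) (K := 1 + M + |ω|) (a := 0) (b := b)
    (hg.continuous.prodMk hg₁c).continuousOn
    (fun t ht => (hgd t ht.1).prodMk (hg₁d t).hasDerivWithinAt)
    (by simp only [h0, hc0]; rfl) (fun t _ => by
      have hM0 : 0 ≤ M := (abs_nonneg _).trans (hM 0)
      have hω0 := abs_nonneg ω
      rw [Prod.norm_mk, Prod.norm_mk]
      have a1 := le_max_left ‖g t‖ ‖g₁ t‖
      have a2 := le_max_right ‖g t‖ ‖g₁ t‖
      have a0 : 0 ≤ max ‖g t‖ ‖g₁ t‖ := (norm_nonneg _).trans a1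
      refine max_le (by nlinarith) ?_
      have h1 : ‖-k t‖ ≤ (M + |ω|) * ‖g t‖ := by
        rw [norm_neg, hk, norm_mul]
        refine mul_le_mul_of_nonneg_right ?_ (norm_nonneg _)
        exact (norm_sub_le _ _).trans (add_le_add_left (hM t) _)
      refine h1.trans (mul_le_mul (by linarith) a1 (norm_nonneg _) (by linarith))) b ⟨hb, le_rfl⟩
  exact (Prod.mk.inj hzero).1

/-- A kernel function which vanishes at the origin is zero. -/
theorem eq_zero_of_form_eq_zero {ω γ : ℝ} {U Ψ Ψ₁ : ℝ → ℝ} (hU : Continuous U)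
    {M : ℝ} (hM : ∀ x, |U (|x|)| ≤ M)
    (hΨ : IsDecayingSolution ω U Ψ Ψ₁) (hΨ0 : Ψ 0 ≠ 0)
    {g g' : ℝ → ℝ} (hg : IsH1 g g') (h0 : g 0 = 0)
    (hker : ∀ z z' : ℝ → ℝ, IsH1 z z' → form ω γ (fun x => U |x|) g g' z z' = 0) (x : ℝ) :
    g x = 0 := by
  have hV : Continuous fun x => U |x| := hU.comp continuous_abs
  have hVU : ∀ x : ℝ, 0 ≤ x → U |x| = U x := fun x hx => by rw [abs_of_nonneg hx]
  rcases le_total 0 x with hx | hx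
  · exact eq_zero_of_nonneg_of_form_eq_zero hV hM hVU hΨ hΨ0 hg h0 hker x hx
  · have h1 := eq_zero_of_nonneg_of_form_eq_zero (γ := γ) hV hM hVU hΨ hΨ0 hg.comp_neg
      (by simpa using h0) (fun z z' hz => by
        rw [form_comp_neg (fun x => by simp only [abs_neg])]
        exact hker _ _ hz.comp_neg) (-x) (neg_nonneg.2 hx)
    simpa using h1

end HalfLine

/-! ### The explicit profile and its differential equations -/

section Profile

/-- The argument of the hyperbolic functions in the profile, continued from the positive half-line
to a linear function. -/
def phase (p ω γ x : ℝ) : ℝ := (p - 1) * √ω / 2 * x + Real.artanh (γ / (2 * √ω))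

/-- The smooth function which agrees with `φ ^ (p - 1)` on the positive half-line. -/
def halfPotential (p ω γ x : ℝ) : ℝ := (p + 1) * ω / 2 * (1 / Real.cosh (phase p ω γ x)) ^ 2

/-- The smooth function which agrees with `φ` on the positive half-line. -/
def halfProfile (p ω γ x : ℝ) : ℝ := halfPotential p ω γ x ^ (1 / (p - 1))

/-- The logarithmic derivative of `halfProfile`. -/
def halfLogDeriv (p ω γ x : ℝ) : ℝ := -√ω * Real.tanh (phase p ω γ x)

theorem phi_eq_halfProfile (p ω γ x : ℝ) : phi p ω γ x = halfProfile p ω γ |x| := rfl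

variable {p ω γ : ℝ}

theorem halfPotential_pos (hp : 1 < p) (hω : 0 < ω) (x : ℝ) : 0 < halfPotential p ω γ x := by
  have := Real.cosh_pos (phase p ω γ x)
  unfold halfPotential
  positivity

theorem halfProfile_pos (hp : 1 < p) (hω : 0 < ω) (x : ℝ) : 0 < halfProfile p ω γ x :=
  Real.rpow_pos_of_pos (halfPotential_pos hp hω x) _

theorem phi_rpow (hp : 1 < p) (hω : 0 < ω) (x : ℝ) :
    phi p ω γ x ^ (p - 1) = halfPotential p ω γ |x| := by
  rw [phi_eq_halfProfile, halfProfile, ← Real.rpow_mul (halfPotential_pos hp hω _).le,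
    one_div_mul_cancel (by linarith), Real.rpow_one]

/-- This is $\mathrm{sech}^2=1-\tanh^2$; it expresses the zero-energy first integral
$\Psi'^2=\omega\Psi^2-\frac{2}{p+1}\Psi^{p+1}$ of the profile equation. -/
theorem halfPotential_eq (hω : 0 < ω) (x : ℝ) :
    halfPotential p ω γ x = (p + 1) / 2 * (ω - halfLogDeriv p ω γ x ^ 2) := by
  have hc := (Real.cosh_pos (phase p ω γ x)).ne'
  have hs := Real.cosh_sq (phase p ω γ x)
  rw [halfLogDeriv, mul_pow, neg_sq, Real.sq_sqrt hω.le, Real.tanh_eq_sinh_div_cosh, halfPotential]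
  field_simp
  rw [hs]
  ring

theorem sq_halfLogDeriv_le (hω : 0 < ω) (x : ℝ) : halfLogDeriv p ω γ x ^ 2 ≤ ω := by
  rw [halfLogDeriv, mul_pow, neg_sq, Real.sq_sqrt hω.le]
  exact mul_le_of_le_one_right hω.le (Real.tanh_sq_lt_one _).le

theorem abs_halfLogDeriv_le (hω : 0 < ω) (x : ℝ) : |halfLogDeriv p ω γ x| ≤ √ω :=
  Real.abs_le_sqrt (sq_halfLogDeriv_le hω x)

theorem halfPotential_le (hp : 1 < p) (hω : 0 < ω) (x : ℝ) :
    halfPotential p ω γ x ≤ (p + 1) / 2 * ω := by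
  rw [halfPotential_eq hω]
  refine mul_le_mul_of_nonneg_left ?_ (by linarith)
  linarith [sq_nonneg (halfLogDeriv p ω γ x)]

theorem hasDerivAt_phase (x : ℝ) : HasDerivAt (phase p ω γ) ((p - 1) * √ω / 2) x := by
  exact HasDerivAt.congr_deriv (f := phase p ω γ) (((hasDerivAt_id x).const_mul
    ((p - 1) * √ω / 2)).add_const (Real.artanh (γ / (2 * √ω)))) (mul_one _)

theorem hasDerivAt_halfPotential (x : ℝ) : HasDerivAt (halfPotential p ω γ)
    ((p - 1) * halfLogDeriv p ω γ x * halfPotential p ω γ x) x := by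
  have hc := (Real.cosh_pos (phase p ω γ x)).ne'
  have h1 : HasDerivAt (fun y => Real.cosh (phase p ω γ y))
      (Real.sinh (phase p ω γ x) * ((p - 1) * √ω / 2)) x :=
    (hasDerivAt_phase x).cosh
  have h2 := (((hasDerivAt_const x (1 : ℝ)).div h1 hc).pow 2).const_mul ((p + 1) * ω / 2)
  refine HasDerivAt.congr_deriv (f := halfPotential p ω γ) h2 ?_
  rw [halfLogDeriv, Real.tanh_eq_sinh_div_cosh, halfPotential]
  simp only [Pi.div_apply, Nat.add_one_sub_one, pow_one]
  field_simp
  push_cast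
  ring

/-- The Riccati form of $\Psi''=(\omega-\Psi^{p-1})\Psi$, with $a=\Psi'/\Psi$. -/
theorem hasDerivAt_halfLogDeriv (hω : 0 < ω) (x : ℝ) :
    HasDerivAt (halfLogDeriv p ω γ)
      (ω - halfPotential p ω γ x - halfLogDeriv p ω γ x ^ 2) x := by
  have hc := (Real.cosh_pos (phase p ω γ x)).ne'
  have hs := Real.cosh_sq (phase p ω γ x)
  have hq : √ω ^ 2 = ω := Real.sq_sqrt hω.le
  have h1 := ((hasDerivAt_phase (p := p) (ω := ω) (γ := γ) x).sinh.div
    (hasDerivAt_phase x).cosh hc).const_mul (-√ω)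
  have e : halfLogDeriv p ω γ = fun y => -√ω *
      ((fun x => Real.sinh (phase p ω γ x)) / fun x => Real.cosh (phase p ω γ x)) y := by
    funext y
    rw [halfLogDeriv, Real.tanh_eq_sinh_div_cosh]
    rfl
  rw [e]
  refine h1.congr_deriv ?_
  simp only [Pi.div_apply]
  rw [halfPotential, mul_pow, neg_sq, hq]
  field_simp
  have : √ω * √ω = ω := Real.mul_self_sqrt hω.le
  rw [hs]
  ring_nf
  rw [hq]
  ring

theorem hasDerivAt_halfProfile (hp : 1 < p) (hω : 0 < ω) (x : ℝ) :
    HasDerivAt (halfProfile p ω γ) (halfLogDeriv p ω γ x * halfProfile p ω γ x) x := by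
  have hU := halfPotential_pos (γ := γ) hp hω x
  have h1 := (hasDerivAt_halfPotential (p := p) (ω := ω) (γ := γ) x).rpow_const
    (p := 1 / (p - 1)) (Or.inl hU.ne')
  refine HasDerivAt.congr_deriv (f := halfProfile p ω γ) h1 ?_
  rw [Real.rpow_sub_one hU.ne', halfProfile]
  have : p - 1 ≠ 0 := by linarith
  field_simp

theorem continuous_halfPotential : Continuous (halfPotential p ω γ) :=
  continuous_iff_continuousAt.2 fun x => (hasDerivAt_halfPotential x).continuousAt

theorem halfPotential_le_exp (hp : 1 < p) (hω : 0 < ω) (x : ℝ) :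
    halfPotential p ω γ x ≤ 2 * (p + 1) * ω * Real.exp (-2 * phase p ω γ x) := by
  set y := phase p ω γ x with hy
  have h1 : Real.exp y / 2 ≤ Real.cosh y := by
    rw [Real.cosh_eq]
    linarith [Real.exp_pos (-y)]
  have h2 : 1 / Real.cosh y ≤ 2 * Real.exp (-y) := by
    rw [div_le_iff₀ (Real.cosh_pos y)]
    have : Real.exp (-y) * Real.exp y = 1 := by rw [← Real.exp_add]; simp
    nlinarith [Real.exp_pos (-y)]
  have h3 : (1 / Real.cosh y) ^ 2 ≤ (2 * Real.exp (-y)) ^ 2 :=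
    pow_le_pow_left₀ (by have := Real.cosh_pos y; positivity) h2 2
  have h4 : (2 * Real.exp (-y)) ^ 2 = 4 * Real.exp (-2 * y) := by
    rw [mul_pow, ← Real.exp_nat_mul]
    norm_num
  rw [halfPotential, ← hy]
  have hA : 0 ≤ (p + 1) * ω / 2 := by
    have : 0 < p + 1 := by linarith
    positivity
  calc _ ≤ (p + 1) * ω / 2 * (4 * Real.exp (-2 * y)) := by
        rw [← h4]; exact mul_le_mul_of_nonneg_left h3 hA
    _ = _ := by ring

theorem tendsto_halfPotential (hp : 1 < p) (hω : 0 < ω) :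
    Filter.Tendsto (halfPotential p ω γ) Filter.atTop (nhds 0) := by
  have hphase : Filter.Tendsto (phase p ω γ) Filter.atTop Filter.atTop := by
    refine Filter.tendsto_atTop_add_const_right _ _ (Filter.Tendsto.const_mul_atTop ?_
      Filter.tendsto_id)
    have : 0 < p - 1 := by linarith
    positivity
  have h1 : Filter.Tendsto (fun x => 2 * (p + 1) * ω * Real.exp (-2 * phase p ω γ x))
      Filter.atTop (nhds (2 * (p + 1) * ω * 0)) := by
    refine Filter.Tendsto.const_mul _ (Real.tendsto_exp_atBot.comp ?_)
    exact hphase.const_mul_atTop_of_neg (by norm_num)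
  rw [mul_zero] at h1
  exact squeeze_zero (fun x => (halfPotential_pos hp hω x).le)
    (fun x => halfPotential_le_exp hp hω x) h1

theorem memLp_halfProfile (hp : 1 < p) (hω : 0 < ω) :
    MemLp (halfProfile p ω γ) 2 (volume.restrict (Set.Ioi 0)) := by
  have hq : 0 < p - 1 := by linarith
  have hq' : 0 < 1 / (p - 1) := by positivity
  have hc : Continuous (halfProfile p ω γ) :=
    continuous_iff_continuousAt.2 fun x => (hasDerivAt_halfProfile hp hω x).continuousAt
  set C := (2 * (p + 1) * ω) ^ (1 / (p - 1)) *
    Real.exp (-2 * Real.artanh (γ / (2 * √ω)) * (1 / (p - 1))) with hC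
  -- The phase has slope $(p-1)\sqrt\omega/2$, so the power $1/(p-1)$ of $e^{-2\,\mathrm{phase}}$
  -- decays exactly like $e^{-\sqrt\omega x}$.
  have hle : ∀ x, halfProfile p ω γ x ≤ C * Real.exp (-√ω * x) := by
    intro x
    have h1 := Real.rpow_le_rpow (halfPotential_pos hp hω x).le
      (halfPotential_le_exp (γ := γ) hp hω x) hq'.le
    refine h1.trans (le_of_eq ?_)
    have h2 : Real.exp (-2 * phase p ω γ x * (1 / (p - 1))) =
        Real.exp (-2 * Real.artanh (γ / (2 * √ω)) * (1 / (p - 1))) * Real.exp (-√ω * x) := by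
      rw [← Real.exp_add, phase]
      congr 1
      field_simp
      ring
    rw [Real.mul_rpow (by positivity) (Real.exp_pos _).le, ← Real.exp_mul, h2, hC]
    ring
  have hexp : MemLp (fun x => C * Real.exp (-√ω * x)) 2 (volume.restrict (Set.Ioi 0)) := by
    have hm : Continuous fun x : ℝ => C * Real.exp (-√ω * x) := by fun_prop
    rw [memLp_two_iff_integrable_sq hm.aestronglyMeasurable]
    have h1 := (integrableOn_exp_mul_Ioi (a := -2 * √ω)
      (by have := Real.sqrt_pos.2 hω; linarith) 0).const_mul (C ^ 2)
    refine h1.congr (Filter.Eventually.of_forall fun x => ?_)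
    simp only
    have h2 : Real.exp (-2 * √ω * x) = Real.exp (-√ω * x) ^ 2 := by
      rw [← Real.exp_nat_mul]
      congr 1
      push_cast
      ring
    rw [h2]
    exact (mul_pow _ _ 2).symm
  refine hexp.mono hc.aestronglyMeasurable (Filter.Eventually.of_forall fun x => ?_)
  rw [Real.norm_of_nonneg (halfProfile_pos hp hω x).le]
  exact (hle x).trans (le_abs_self _)

theorem memLp_mul_halfProfile (hp : 1 < p) (hω : 0 < ω) {F : ℝ → ℝ} (hF : Continuous F) {C : ℝ}
    (hC : ∀ x, |F x| ≤ C) :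
    MemLp (fun x => F x * halfProfile p ω γ x) 2 (volume.restrict (Set.Ioi 0)) := by
  refine (memLp_halfProfile (γ := γ) hp hω).of_le_mul (c := C)
    (hF.aestronglyMeasurable.mul (memLp_halfProfile hp hω).1)
    (Filter.Eventually.of_forall fun x => ?_)
  rw [norm_mul]
  exact mul_le_mul_of_nonneg_right (hC x) (norm_nonneg _)

theorem continuous_halfLogDeriv (hω : 0 < ω) : Continuous (halfLogDeriv p ω γ) :=
  continuous_iff_continuousAt.2 fun x => (hasDerivAt_halfLogDeriv hω x).continuousAt

/-- The profile solves `Ψ'' = (ω - φ ^ (p - 1)) Ψ`. -/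
theorem isDecayingSolution_halfProfile (hp : 1 < p) (hω : 0 < ω) :
    IsDecayingSolution ω (halfPotential p ω γ) (halfProfile p ω γ)
      (fun x => halfLogDeriv p ω γ x * halfProfile p ω γ x) where
  hasDerivAt := hasDerivAt_halfProfile hp hω
  hasDerivAt_deriv x := by
    refine ((hasDerivAt_halfLogDeriv hω x).mul (hasDerivAt_halfProfile hp hω x)).congr_deriv ?_
    ring
  memLp := memLp_halfProfile hp hω
  memLp_deriv := memLp_mul_halfProfile hp hω (continuous_halfLogDeriv hω)
    (abs_halfLogDeriv_le hω)

/-- The derivative of the profile solves `Ψ'' = (ω - p φ ^ (p - 1)) Ψ`. -/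
theorem isDecayingSolution_halfProfile_deriv (hp : 1 < p) (hω : 0 < ω) :
    IsDecayingSolution ω (fun x => p * halfPotential p ω γ x)
      (fun x => halfLogDeriv p ω γ x * halfProfile p ω γ x)
      (fun x => (ω - halfPotential p ω γ x) * halfProfile p ω γ x) where
  hasDerivAt := (isDecayingSolution_halfProfile hp hω).hasDerivAt_deriv
  hasDerivAt_deriv x := by
    -- With $U=\Psi^{p-1}$ and $a=\Psi'/\Psi$, $U'=(p-1)aU$ supplies the missing $(p-1)U$ that turns
    -- $\omega-U$ into $\omega-pU$.
    refine (((hasDerivAt_halfPotential x).const_sub ω).mul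
      (hasDerivAt_halfProfile hp hω x)).congr_deriv ?_
    ring
  memLp := (isDecayingSolution_halfProfile hp hω).memLp_deriv
  memLp_deriv := memLp_mul_halfProfile hp hω (C := ω + (p + 1) / 2 * ω)
    (continuous_const.sub continuous_halfPotential) fun x => by
      refine (abs_sub _ _).trans ?_
      rw [abs_of_pos hω, abs_of_pos (halfPotential_pos hp hω x)]
      linarith [halfPotential_le (γ := γ) hp hω x]

theorem omega_pos (hω : γ ^ 2 / 4 < ω) : 0 < ω := lt_of_le_of_lt (by positivity) hω

/-- The jump condition of the delta interaction, the reason for the shift by $\tanh^{-1}$ in the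
profile; $\omega>\gamma^2/4$ puts its argument in $(-1,1)$. -/
theorem halfLogDeriv_zero (hω : γ ^ 2 / 4 < ω) : halfLogDeriv p ω γ 0 = -(γ / 2) := by
  have h0 := omega_pos hω
  have hs := Real.sqrt_pos.2 h0
  have hmem : γ / (2 * √ω) ∈ Set.Ioo (-1 : ℝ) 1 := by
    rw [Set.mem_Ioo, ← abs_lt, abs_div, abs_of_pos (by positivity : 0 < 2 * √ω), div_lt_one (by positivity)]
    refine abs_lt_of_sq_lt_sq ?_ (by positivity)
    rw [mul_pow, Real.sq_sqrt h0.le]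
    linarith
  rw [halfLogDeriv, phase, mul_zero, zero_add, Real.tanh_artanh hmem]
  field_simp

end Profile

/-! ### The kernels of $L_1$ and $L_2$ -/

section Kernel

variable {p ω γ : ℝ}

theorem abs_halfPotential_abs_le (hp : 1 < p) (hω : 0 < ω) (x : ℝ) :
    |halfPotential p ω γ (|x|)| ≤ (p + 1) / 2 * ω := by
  rw [abs_of_pos (halfPotential_pos hp hω _)]
  exact halfPotential_le hp hω _

theorem integral_coeFn_zero_mul (z : ℝ → ℝ) : ∫ x, (0 : L2R) x * z x = 0 := by
  rw [← integral_zero ℝ ℝ (μ := volume)]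
  refine integral_congr_ae ?_
  filter_upwards [Lp.coeFn_zero ℝ 2 (volume : Measure ℝ)] with x hx
  rw [hx]
  simp

/-- The kernel of `L₁` is trivial. -/
theorem eq_zero_of_represents_zero₁ (hp : 1 < p) (hγ : γ ≠ 0) (hω : γ ^ 2 / 4 < ω) {v : L2R}
    (h : Represents ω γ (fun x => p * phi p ω γ x ^ (p - 1)) v 0) : v = 0 := by
  have h0 := omega_pos hω
  have hp0 : 0 < p := by linarith
  obtain ⟨f, f', hf, hvf, hB⟩ := h
  have hV : (fun x => p * phi p ω γ x ^ (p - 1)) = fun x => (fun y => p * halfPotential p ω γ y) |x| :=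
    funext fun x => by simp only [phi_rpow hp h0]
  rw [hV] at hB
  simp only [integral_coeFn_zero_mul] at hB
  have hΨ := isDecayingSolution_halfProfile_deriv (γ := γ) hp h0
  have hc : Continuous fun y => p * halfPotential p ω γ y :=
    continuous_const.mul continuous_halfPotential
  have hM : ∀ x : ℝ, |(fun y => p * halfPotential p ω γ y) (|x|)| ≤ p * ((p + 1) / 2 * ω) := by
    intro x
    simp only
    rw [abs_mul, abs_of_pos hp0]
    exact mul_le_mul_of_nonneg_left (abs_halfPotential_abs_le hp h0 x) hp0.le
  have hΦ := (halfProfile_pos (γ := γ) hp h0 0).ne'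
  -- Pair `f` with the even extension of $\Psi'$: the kernel relation gives $0$, integration by
  -- parts gives $-(2\Psi''(0)+\gamma\Psi'(0))f(0)$, whose factor is nonzero.
  have hf0 : f 0 = 0 := by
    have h1 := hΨ.form_comp_abs (γ := γ) hc hM hf
    rw [form_symm, hB _ _ hΨ.isH1_comp_abs] at h1
    refine (mul_eq_zero.1 h1.symm).resolve_left ?_
    rw [halfPotential_eq h0, halfLogDeriv_zero hω]
    have e : -(2 * ((ω - (p + 1) / 2 * (ω - (-(γ / 2)) ^ 2)) * halfProfile p ω γ 0) +
        γ * (-(γ / 2) * halfProfile p ω γ 0)) =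
        (p - 1) * (ω - γ ^ 2 / 4) * halfProfile p ω γ 0 := by ring
    rw [e]
    exact mul_ne_zero (mul_ne_zero (by linarith) (by linarith)) hΦ
  -- Here $\gamma\ne0$ is essential: $\Psi'(0)=-\frac\gamma2\Psi(0)$. For $\gamma=0$ the odd
  -- function $\varphi'$ does lie in the kernel.
  have hzero := eq_zero_of_form_eq_zero hc hM hΨ
    (by
      rw [halfLogDeriv_zero hω]
      exact mul_ne_zero (neg_ne_zero.2 (by simpa using hγ)) hΦ) hf hf0 hB
  refine Lp.ext ?_
  filter_upwards [hvf, Lp.coeFn_zero ℝ 2 (volume : Measure ℝ)] with x h1 h2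
  rw [h1, hzero, h2]
  rfl

theorem isH1_phi (hp : 1 < p) (hω : 0 < ω) : IsH1 (phi p ω γ)
    (evenDeriv fun x => halfLogDeriv p ω γ x * halfProfile p ω γ x) :=
  (isDecayingSolution_halfProfile hp hω).isH1_comp_abs

/-- The boundary factor $2\Psi'(0)+\gamma\Psi(0)$ vanishes by the jump condition. -/
theorem form_phi (hp : 1 < p) (hω : γ ^ 2 / 4 < ω) {z z' : ℝ → ℝ} (hz : IsH1 z z') :
    form ω γ (fun x => phi p ω γ x ^ (p - 1)) (phi p ω γ)
      (evenDeriv fun x => halfLogDeriv p ω γ x * halfProfile p ω γ x) z z' = 0 := by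
  have h0 := omega_pos hω
  have hV : (fun x => phi p ω γ x ^ (p - 1)) = fun x => halfPotential p ω γ |x| :=
    funext fun x => phi_rpow hp h0 x
  have h1 := (isDecayingSolution_halfProfile (γ := γ) hp h0).form_comp_abs (γ := γ)
    continuous_halfPotential (abs_halfPotential_abs_le hp h0) hz
  rw [halfLogDeriv_zero hω] at h1
  rw [hV]
  refine h1.trans ?_
  ring

/-- The kernel of `L₂` is spanned by `φ`. -/
theorem represents_zero_iff (hp : 1 < p) (hω : γ ^ 2 / 4 < ω) {v : L2R} :
    Represents ω γ (fun x => phi p ω γ x ^ (p - 1)) v 0 ↔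
      ∃ c : ℝ, v =ᵐ[volume] fun x => c * phi p ω γ x := by
  have h0 := omega_pos hω
  have hφ := isH1_phi (γ := γ) hp h0
  have hV : (fun x => phi p ω γ x ^ (p - 1)) = fun x => halfPotential p ω γ |x| :=
    funext fun x => phi_rpow hp h0 x
  have hVm : Measurable fun x => halfPotential p ω γ |x| :=
    (continuous_halfPotential.comp continuous_abs).measurable
  constructor
  · rintro ⟨f, f', hf, hvf, hB⟩
    simp only [integral_coeFn_zero_mul] at hB
    have hφ0 : phi p ω γ 0 ≠ 0 := by
      rw [phi_eq_halfProfile]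
      exact (halfProfile_pos hp h0 _).ne'
    -- Chosen so that $f-c\varphi$ is a kernel element vanishing at the origin.
    set c := f 0 / phi p ω γ 0 with hc
    refine ⟨c, ?_⟩
    have hg := hf.add (hφ.smul (-c))
    have hzero := eq_zero_of_form_eq_zero (γ := γ) continuous_halfPotential
      (abs_halfPotential_abs_le hp h0)
      (isDecayingSolution_halfProfile (γ := γ) hp h0) (halfProfile_pos hp h0 0).ne' hg
      (by
        simp only [Pi.add_apply, Pi.smul_apply, smul_eq_mul, hc]
        field_simp
        ring)
      (fun z z' hz => by
        rw [form_add hVm ⟨_, abs_halfPotential_abs_le hp h0⟩ hf (hφ.smul (-c)) hz, form_smul,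
          ← hV, hB z z' hz, form_phi hp hω hz, mul_zero, add_zero])
    filter_upwards [hvf] with x hx
    have h1 := hzero x
    simp only [Pi.add_apply, Pi.smul_apply, smul_eq_mul] at h1
    rw [hx]
    linarith
  · rintro ⟨c, hc⟩
    refine ⟨c • phi p ω γ, _, hφ.smul c, hc, fun z z' hz => ?_⟩
    rw [form_smul, form_phi hp hω hz, mul_zero, integral_coeFn_zero_mul]

end Kernel

/-! ### From the form to the operator -/

section FormOperator

open scoped InnerProductSpace

variable {ω γ : ℝ} {V : ℝ → ℝ} {hV : Measurable V} {hb : ∃ C, ∀ x, |V x| ≤ C}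

theorem represents_formOperator (v : (formOperator ω γ V hV hb).domain) :
    Represents ω γ V v (formOperator ω γ V hV hb v) :=
  v.2.choose_spec

theorem formOperator_eq_iff (v : (formOperator ω γ V hV hb).domain) (w : L2R) :
    formOperator ω γ V hV hb v = w ↔ Represents ω γ V v w :=
  ⟨fun h => h ▸ represents_formOperator v, represents_unique (represents_formOperator v)⟩

/-- The continuous representative of an element of the domain. -/
def domainRep (v : (formOperator ω γ V hV hb).domain) : ℝ → ℝ :=
  (represents_formOperator v).choose

theorem domainRep_spec (v : (formOperator ω γ V hV hb).domain) :
    ∃ f' : ℝ → ℝ, IsH1 (domainRep v) f' ∧ (v : L2R) =ᵐ[volume] domainRep v ∧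
      ∀ z z' : ℝ → ℝ, IsH1 z z' → form ω γ V (domainRep v) f' z z' =
        ∫ x, formOperator ω γ V hV hb v x * z x :=
  (represents_formOperator v).choose_spec

theorem domainRep_unique {v : (formOperator ω γ V hV hb).domain} {f f' : ℝ → ℝ}
    (hf : IsH1 f f') (h : (v : L2R) =ᵐ[volume] f) : domainRep v = f := by
  obtain ⟨g', hg, hvg, -⟩ := domainRep_spec v
  exact (hg.continuous.ae_eq_iff_eq volume hf.continuous).1 (hvg.symm.trans h)

/-- Evaluation of the elements of the domain at the points of a finite set. -/
def evalAt (T : Finset ℝ) : (formOperator ω γ V hV hb).domain →ₗ[ℝ] (T → ℝ) where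
  toFun v t := domainRep v t
  map_add' v w := by
    obtain ⟨f', hf, hvf, -⟩ := domainRep_spec v
    obtain ⟨g', hg, hwg, -⟩ := domainRep_spec w
    have h : domainRep (v + w) = domainRep v + domainRep w :=
      domainRep_unique (hf.add hg) ((Lp.coeFn_add (v : L2R) w).trans (hvf.add hwg))
    rw [h]
    rfl
  map_smul' a v := by
    obtain ⟨f', hf, hvf, -⟩ := domainRep_spec v
    have h : domainRep (a • v) = a • domainRep v :=
      domainRep_unique (hf.smul a) ((Lp.coeFn_smul a (v : L2R)).trans (hvf.const_smul a))
    rw [h]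
    rfl

/-- Both inner products are values of the symmetric form. -/
theorem isSymmetricOp_formOperator : IsSymmetricOp (formOperator ω γ V hV hb) := by
  intro v w
  obtain ⟨f', hf, hvf, hB⟩ := domainRep_spec v
  obtain ⟨g', hg, hwg, hC⟩ := domainRep_spec w
  rw [inner_eq_integral Filter.EventuallyEq.rfl hwg, ← hB _ _ hg, real_inner_comm,
    inner_eq_integral Filter.EventuallyEq.rfl hvf, ← hC _ _ hf, form_symm]

theorem inner_formOperator_self (v : (formOperator ω γ V hV hb).domain) :
    ∃ f' : ℝ → ℝ, IsH1 (domainRep v) f' ∧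
      ⟪formOperator ω γ V hV hb v, (v : L2R)⟫_ℝ = form ω γ V (domainRep v) f' (domainRep v) f' ∧
      ‖(v : L2R)‖ ^ 2 = ∫ x, domainRep v x * domainRep v x := by
  obtain ⟨f', hf, hvf, hB⟩ := domainRep_spec v
  exact ⟨f', hf, by rw [inner_eq_integral Filter.EventuallyEq.rfl hvf, hB _ _ hf],
    norm_sq_eq_integral hvf⟩

theorem formOperator_ge {M s : ℝ} (hM : ∀ x, |V x| ≤ M)
    (hs : M + 8 * (|γ| + 1) ^ 2 + 1 ≤ ω - s) (v : (formOperator ω γ V hV hb).domain) :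
    (s + 1) * ‖(v : L2R)‖ ^ 2 ≤ ⟪formOperator ω γ V hV hb v, (v : L2R)⟫_ℝ := by
  obtain ⟨f', hf, h1, h2⟩ := inner_formOperator_self v
  have h3 := form_coercive hV hM hs hf
  rw [form_shift] at h3
  have hD : 0 ≤ ∫ x, f' x * f' x := integral_nonneg fun x => mul_self_nonneg _
  rw [h1, h2]
  linarith

theorem exists_formOperator_sub_eq {M s : ℝ} (hM : ∀ x, |V x| ≤ M)
    (hs : M + 8 * (|γ| + 1) ^ 2 + 1 ≤ ω - s) (w : L2R) :
    ∃ v : (formOperator ω γ V hV hb).domain, formOperator ω γ V hV hb v - s • (v : L2R) = w := by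
  obtain ⟨v, hv⟩ := exists_represents_sub hV hM hs w
  refine ⟨⟨v, _, hv⟩, ?_⟩
  rw [(formOperator_eq_iff _ _).2 hv, add_sub_cancel_right]

theorem exists_finset_formOperator_ge {R : ℝ} (hω : 0 < ω) (hR : ∀ x, R ≤ |x| → V x ≤ ω / 2) :
    ∃ T : Finset ℝ, ∀ v : (formOperator ω γ V hV hb).domain, evalAt T v = 0 →
      ω / 2 * ‖(v : L2R)‖ ^ 2 ≤ ⟪formOperator ω γ V hV hb v, (v : L2R)⟫_ℝ := by
  obtain ⟨M, hM⟩ := id hb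
  obtain ⟨T, hT⟩ := exists_finset_form_ge (γ := γ) hω hV hM hR
  refine ⟨T, fun v hv => ?_⟩
  obtain ⟨f', hf, h1, h2⟩ := inner_formOperator_self v
  rw [h1, h2]
  exact hT _ _ hf fun x hx => congrFun hv ⟨x, hx⟩

end FormOperator

/-! ### $L^2(\mathbb{R},\mathbb{C})$ as the orthogonal sum of two copies of
$L^2(\mathbb{R},\mathbb{R})$ -/

section Complex

open scoped InnerProductSpace

theorem coeFn_rePart (u : L2C) : rePart u =ᵐ[volume] fun x => (u x).re :=
  Complex.reCLM.coeFn_compLpL u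

theorem coeFn_imPart (u : L2C) : imPart u =ᵐ[volume] fun x => (u x).im :=
  Complex.imCLM.coeFn_compLpL u

theorem coeFn_ofReal (u : L2R) : ofReal u =ᵐ[volume] fun x => ((u x : ℝ) : ℂ) :=
  Complex.ofRealCLM.coeFn_compLpL u

theorem coeFn_ofReal_add_I_smul (a b : L2R) :
    (ofReal a + Complex.I • ofReal b : L2C) =ᵐ[volume] fun x => (a x : ℂ) + Complex.I * (b x : ℂ) := by
  filter_upwards [Lp.coeFn_add (ofReal a) (Complex.I • ofReal b),
    Lp.coeFn_smul Complex.I (ofReal b), coeFn_ofReal a, coeFn_ofReal b] with x h1 h2 h3 h4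
  rw [h1, Pi.add_apply, h2, Pi.smul_apply, h3, h4, smul_eq_mul]

theorem rePart_ofReal_add_I_smul (a b : L2R) :
    rePart (ofReal a + Complex.I • ofReal b) = a := by
  refine Lp.ext ?_
  filter_upwards [coeFn_rePart (ofReal a + Complex.I • ofReal b),
    coeFn_ofReal_add_I_smul a b] with x h1 h2
  rw [h1, h2]
  simp

theorem imPart_ofReal_add_I_smul (a b : L2R) :
    imPart (ofReal a + Complex.I • ofReal b) = b := by
  refine Lp.ext ?_
  filter_upwards [coeFn_imPart (ofReal a + Complex.I • ofReal b),
    coeFn_ofReal_add_I_smul a b] with x h1 h2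
  rw [h1, h2]
  simp

theorem ofReal_rePart_add_I_smul (u : L2C) :
    ofReal (rePart u) + Complex.I • ofReal (imPart u) = u := by
  refine Lp.ext ?_
  filter_upwards [coeFn_rePart u, coeFn_imPart u,
    coeFn_ofReal_add_I_smul (rePart u) (imPart u)] with x h1 h2 h3
  rw [h3, h1, h2, mul_comm]
  exact Complex.re_add_im _

theorem ext_rePart_imPart {u v : L2C} (h1 : rePart u = rePart v) (h2 : imPart u = imPart v) :
    u = v := by
  rw [← ofReal_rePart_add_I_smul u, h1, h2, ofReal_rePart_add_I_smul]

theorem inner_eq_rePart_add_imPart (u v : L2C) :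
    ⟪u, v⟫_ℝ = ⟪rePart u, rePart v⟫_ℝ + ⟪imPart u, imPart v⟫_ℝ := by
  rw [L2.inner_def, L2.inner_def, L2.inner_def,
    ← integral_add (L2.integrable_inner _ _) (L2.integrable_inner _ _)]
  refine integral_congr_ae ?_
  filter_upwards [coeFn_rePart u, coeFn_imPart u, coeFn_rePart v, coeFn_imPart v]
    with x h1 h2 h3 h4
  rw [h1, h2, h3, h4, Complex.inner]
  simp

theorem norm_sq_eq_rePart_add_imPart (u : L2C) :
    ‖u‖ ^ 2 = ‖rePart u‖ ^ 2 + ‖imPart u‖ ^ 2 := by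
  rw [← real_inner_self_eq_norm_sq, inner_eq_rePart_add_imPart, real_inner_self_eq_norm_sq,
    real_inner_self_eq_norm_sq]

end Complex

/-! ### The operator $H$: symmetry, resolvent, lower bound and kernel -/

section OpH

open scoped InnerProductSpace

variable {p ω γ : ℝ} (hp : 1 < p) (hω : γ ^ 2 / 4 < ω)

/-- The real part on the domain of `H`. -/
def domainRe : (opH hp hω).domain →ₗ[ℝ] (opL₁ hp hω).domain :=
  LinearMap.codRestrict _ ((rePart : L2C →ₗ[ℝ] L2R) ∘ₗ (opH hp hω).domain.subtype) fun u => u.2.1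

/-- The imaginary part on the domain of `H`. -/
def domainIm : (opH hp hω).domain →ₗ[ℝ] (opL₂ hp hω).domain :=
  LinearMap.codRestrict _ ((imPart : L2C →ₗ[ℝ] L2R) ∘ₗ (opH hp hω).domain.subtype) fun u => u.2.2

theorem coe_domainIm (u : (opH hp hω).domain) : (domainIm hp hω u : L2R) = imPart u := rfl

theorem rePart_opH (u : (opH hp hω).domain) :
    rePart (opH hp hω u) = opL₁ hp hω (domainRe hp hω u) :=
  rePart_ofReal_add_I_smul _ _

theorem imPart_opH (u : (opH hp hω).domain) :
    imPart (opH hp hω u) = opL₂ hp hω (domainIm hp hω u) :=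
  imPart_ofReal_add_I_smul _ _

theorem inner_opH (u : (opH hp hω).domain) (v : L2C) : ⟪opH hp hω u, v⟫_ℝ =
    ⟪opL₁ hp hω (domainRe hp hω u), rePart v⟫_ℝ + ⟪opL₂ hp hω (domainIm hp hω u), imPart v⟫_ℝ := by
  rw [inner_eq_rePart_add_imPart, rePart_opH, imPart_opH]

theorem isSymmetricOp_opH : IsSymmetricOp (opH hp hω) := by
  intro u v
  have h1 := isSymmetricOp_formOperator (domainRe hp hω u) (domainRe hp hω v)
  have h2 := isSymmetricOp_formOperator (domainIm hp hω u) (domainIm hp hω v)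
  rw [inner_eq_rePart_add_imPart, inner_eq_rePart_add_imPart, rePart_opH, imPart_opH,
    rePart_opH, imPart_opH]
  exact congrArg₂ (· + ·) h1 h2

theorem exists_hasResolvent_opH : ∃ s : ℝ, Nonempty (HasResolvent (opH hp hω) s) := by
  obtain ⟨C₁, hC₁⟩ := bounded_phi_pow (γ := γ) hp hω p
  obtain ⟨C₂, hC₂'⟩ := bounded_phi_pow (γ := γ) hp hω 1
  have hC₂ : ∀ x, |phi p ω γ x ^ (p - 1)| ≤ C₂ := by simpa only [one_mul] using hC₂'
  -- A common bound gives one shift `s` that serves both components.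
  set M := max C₁ C₂ with hM
  have hM₁ : ∀ x, |p * phi p ω γ x ^ (p - 1)| ≤ M := fun x => (hC₁ x).trans (le_max_left _ _)
  have hM₂ : ∀ x, |phi p ω γ x ^ (p - 1)| ≤ M := fun x => (hC₂ x).trans (le_max_right _ _)
  set s := ω - (M + 8 * (|γ| + 1) ^ 2 + 1) with hs
  have hs' : M + 8 * (|γ| + 1) ^ 2 + 1 ≤ ω - s := by rw [hs]; linarith
  refine ⟨s, nonempty_hasResolvent (isSymmetricOp_opH hp hω) s (fun u => ?_) fun w => ?_⟩
  · rw [inner_opH, norm_sq_eq_rePart_add_imPart, mul_add]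
    exact add_le_add (formOperator_ge hM₁ hs' (domainRe hp hω u))
      (formOperator_ge hM₂ hs' (domainIm hp hω u))
  · obtain ⟨v₁, hv₁⟩ : ∃ v : (opL₁ hp hω).domain, opL₁ hp hω v - s • (v : L2R) = rePart w :=
      exists_formOperator_sub_eq hM₁ hs' (rePart w)
    obtain ⟨v₂, hv₂⟩ : ∃ v : (opL₂ hp hω).domain, opL₂ hp hω v - s • (v : L2R) = imPart w :=
      exists_formOperator_sub_eq hM₂ hs' (imPart w)
    have hre := rePart_ofReal_add_I_smul (v₁ : L2R) v₂
    have him := imPart_ofReal_add_I_smul (v₁ : L2R) v₂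
    let u : (opH hp hω).domain := ⟨ofReal v₁ + Complex.I • ofReal v₂, by
      change rePart _ ∈ (opL₁ hp hω).domain
      rw [hre]
      exact v₁.2, by
      change imPart _ ∈ (opL₂ hp hω).domain
      rw [him]
      exact v₂.2⟩
    have hu₁ : domainRe hp hω u = v₁ := Subtype.ext hre
    have hu₂ : domainIm hp hω u = v₂ := Subtype.ext him
    refine ⟨u, ext_rePart_imPart ?_ ?_⟩
    · rw [map_sub, map_smul, rePart_opH, hu₁, ← hv₁]
      exact congrArg (fun t => opL₁ hp hω v₁ - s • t) hre
    · rw [map_sub, map_smul, imPart_opH, hu₂, ← hv₂]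
      exact congrArg (fun t => opL₂ hp hω v₂ - s • t) him

theorem exists_finite_codim_opH_ge : ∃ T₁ T₂ : Finset ℝ,
    ∃ ℓ : (opH hp hω).domain →ₗ[ℝ] (T₁ → ℝ) × (T₂ → ℝ), ∀ u, ℓ u = 0 →
      ω / 2 * ‖(u : L2C)‖ ^ 2 ≤ ⟪opH hp hω u, (u : L2C)⟫_ℝ := by
  have h0 := omega_pos hω
  have hp0 : 0 < p := by linarith
  -- The threshold $\omega/(2p)$ makes $p\varphi^{p-1}\le\omega/2$ far out, and since $p>1$ also
  -- $\varphi^{p-1}\le\omega/2$.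
  obtain ⟨R, hR⟩ := Filter.eventually_atTop.1
    ((tendsto_halfPotential (γ := γ) hp h0).eventually_le_const
      (show 0 < ω / (2 * p) by positivity))
  have hle : ∀ x, R ≤ |x| → phi p ω γ x ^ (p - 1) ≤ ω / (2 * p) := fun x hx => by
    rw [phi_rpow hp h0]
    exact hR _ hx
  have hR₁ : ∀ x, R ≤ |x| → p * phi p ω γ x ^ (p - 1) ≤ ω / 2 := fun x hx => by
    refine (mul_le_mul_of_nonneg_left (hle x hx) hp0.le).trans (le_of_eq ?_)
    field_simp
  have hR₂ : ∀ x, R ≤ |x| → phi p ω γ x ^ (p - 1) ≤ ω / 2 := fun x hx => by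
    refine (hle x hx).trans ?_
    exact div_le_div_of_nonneg_left h0.le (by norm_num) (by linarith)
  obtain ⟨T₁, hT₁⟩ : ∃ T : Finset ℝ, ∀ v : (opL₁ hp hω).domain, evalAt T v = 0 →
      ω / 2 * ‖(v : L2R)‖ ^ 2 ≤ ⟪opL₁ hp hω v, (v : L2R)⟫_ℝ :=
    exists_finset_formOperator_ge h0 hR₁
  obtain ⟨T₂, hT₂⟩ : ∃ T : Finset ℝ, ∀ v : (opL₂ hp hω).domain, evalAt T v = 0 →
      ω / 2 * ‖(v : L2R)‖ ^ 2 ≤ ⟪opL₂ hp hω v, (v : L2R)⟫_ℝ :=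
    exists_finset_formOperator_ge h0 hR₂
  refine ⟨T₁, T₂, LinearMap.prod (evalAt T₁ ∘ₗ domainRe hp hω) (evalAt T₂ ∘ₗ domainIm hp hω),
    fun u hu => ?_⟩
  have hu' := Prod.ext_iff.1 hu
  rw [inner_opH, norm_sq_eq_rePart_add_imPart, mul_add]
  exact add_le_add (hT₁ (domainRe hp hω u) hu'.1) (hT₂ (domainIm hp hω u) hu'.2)

theorem opL₁_eq_zero_iff (hγ : γ ≠ 0) (v : (opL₁ hp hω).domain) : opL₁ hp hω v = 0 ↔ v = 0 := by
  refine ⟨fun h => Subtype.ext ?_, fun h => h ▸ LinearPMap.map_zero _⟩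
  exact eq_zero_of_represents_zero₁ hp hγ hω ((formOperator_eq_iff v 0).1 h)

theorem eigenspace_opL₁_zero (hγ : γ ≠ 0) : eigenspace (opL₁ hp hω) 0 = ⊥ := by
  rw [eigenspace_eq_bot_iff]
  intro d hd
  rw [zero_smul] at hd
  exact (opL₁_eq_zero_iff hp hω hγ d).1 hd

theorem memLp_I_mul_phi (hp : 1 < p) (hω : 0 < ω) :
    MemLp (fun x : ℝ => Complex.I * (phi p ω γ x : ℂ)) 2 volume :=
  ((isH1_phi hp hω).memLp.ofReal (K := ℂ)).const_mul Complex.I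

/-- The kernel splits into components: the real part lies in $\ker L_1=\{0\}$, the imaginary part in
$\ker L_2=\mathrm{span}\{\varphi\}$. -/
theorem eigenspace_opH_zero (hγ : γ ≠ 0) : eigenspace (opH hp hω) 0 =
    Submodule.span ℝ {(memLp_I_mul_phi (γ := γ) hp (omega_pos hω)).toLp} := by
  have h0 := omega_pos hω
  have hcoe := (memLp_I_mul_phi (γ := γ) hp h0).coeFn_toLp
  ext u
  rw [mem_eigenspace_iff, Submodule.mem_span_singleton]
  constructor
  · rintro ⟨d, hd, rfl⟩
    rw [zero_smul] at hd
    have h1 : opL₁ hp hω (domainRe hp hω d) = 0 := by rw [← rePart_opH, hd, map_zero]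
    have h2 : opL₂ hp hω (domainIm hp hω d) = 0 := by rw [← imPart_opH, hd, map_zero]
    have hre : rePart (d : L2C) = 0 :=
      congrArg Subtype.val ((opL₁_eq_zero_iff hp hω hγ _).1 h1)
    obtain ⟨c, hc⟩ := (represents_zero_iff hp hω).1 ((formOperator_eq_iff _ 0).1 h2)
    refine ⟨c, Lp.ext ?_⟩
    rw [coe_domainIm] at hc
    have hre' := coeFn_rePart (d : L2C)
    rw [hre] at hre'
    filter_upwards [Lp.coeFn_smul c (memLp_I_mul_phi (γ := γ) hp h0).toLp, hcoe, hc, hre',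
      coeFn_imPart (d : L2C), Lp.coeFn_zero ℝ 2 (volume : Measure ℝ)] with x e1 e2 e3 e4 e5 e6
    rw [e1, Pi.smul_apply, e2]
    rw [e6] at e4
    rw [e5] at e3
    refine Complex.ext ?_ ?_
    · rw [← e4]; simp
    · rw [e3]; simp
  · rintro ⟨c, rfl⟩
    set u := c • (memLp_I_mul_phi (γ := γ) hp h0).toLp with hu
    have hux : u =ᵐ[volume] fun x => Complex.I * ((c * phi p ω γ x : ℝ) : ℂ) := by
      filter_upwards [Lp.coeFn_smul c (memLp_I_mul_phi (γ := γ) hp h0).toLp, hcoe] with x e1 e2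
      rw [e1, Pi.smul_apply, e2, Complex.real_smul]
      push_cast
      ring
    have hre : rePart u = 0 := by
      refine Lp.ext ?_
      filter_upwards [coeFn_rePart u, hux, Lp.coeFn_zero ℝ 2 (volume : Measure ℝ)] with x e1 e2 e3
      rw [e1, e2, e3]
      simp
    have him : imPart u =ᵐ[volume] fun x => c * phi p ω γ x := by
      filter_upwards [coeFn_imPart u, hux] with x e1 e2
      rw [e1, e2]
      simp
    have hrep := (represents_zero_iff hp hω).2 ⟨c, him⟩
    let d : (opH hp hω).domain := ⟨u, by
      change rePart u ∈ (opL₁ hp hω).domain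
      rw [hre]
      exact Submodule.zero_mem _, ⟨0, hrep⟩⟩
    refine ⟨d, ?_, rfl⟩
    rw [zero_smul]
    refine ext_rePart_imPart ?_ ?_
    · rw [rePart_opH, map_zero, opL₁_eq_zero_iff hp hω hγ]
      exact Subtype.ext hre
    · rw [imPart_opH, map_zero]
      exact (formOperator_eq_iff _ _).2 hrep

end OpH

end DeltaNLS

end

theorem lemma6 (p γ ω : ℝ) (hp : 1 < p) (hγ : γ ≠ 0) (hω : γ ^ 2 / 4 < ω) :
    ((DeltaNLS.negEigenvalues (DeltaNLS.opH hp hω)).Finite ∧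
      ∀ l ∈ DeltaNLS.negEigenvalues (DeltaNLS.opH hp hω),
        FiniteDimensional ℝ (DeltaNLS.eigenspace (DeltaNLS.opH hp hω) l)) ∧
    (∃ h : MeasureTheory.MemLp (fun x : ℝ => Complex.I * (DeltaNLS.phi p ω γ x : ℂ)) 2
        MeasureTheory.volume,
      DeltaNLS.eigenspace (DeltaNLS.opH hp hω) 0 = Submodule.span ℝ {h.toLp}) ∧
    (∃ δ : ℝ, 0 < δ ∧
      ∀ z ∈ DeltaNLS.opSpectrum (DeltaNLS.opH hp hω) \
          ((fun l : ℝ => (l : ℂ)) '' (DeltaNLS.negEigenvalues (DeltaNLS.opH hp hω) ∪ {0})),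
        z.im = 0 ∧ δ ≤ z.re) ∧
    DeltaNLS.eigenspace (DeltaNLS.opL₁ hp hω) 0 = ⊥ := by
  have h0 := DeltaNLS.omega_pos hω
  obtain ⟨T₁, T₂, ℓ, hℓ⟩ := DeltaNLS.exists_finite_codim_opH_ge hp hω
  obtain ⟨s, ⟨H⟩⟩ := DeltaNLS.exists_hasResolvent_opH hp hω
  have hsymm := DeltaNLS.isSymmetricOp_opH hp hω
  have hpos : 0 < ω / 2 := by linarith
  refine ⟨⟨?_, fun l hl => ?_⟩, ⟨_, DeltaNLS.eigenspace_opH_zero hp hω hγ⟩,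
    DeltaNLS.exists_spectral_gap hsymm H ℓ hpos hℓ, DeltaNLS.eigenspace_opL₁_zero hp hω hγ⟩
  -- Negative eigenvalues lie below the threshold $\omega/2>0$, so the counting argument applies to
  -- them.
  · exact (DeltaNLS.finite_eigenvalues_lt hsymm ℓ hℓ).subset fun l hl => ⟨hl.1.trans hpos, hl.2⟩
  · exact DeltaNLS.finiteDimensional_eigenspace ℓ hℓ (hl.1.trans hpos)
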